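/- Let $n\ge 2$ and let $B_n$ be the braid group on $n$ strands with Artin generators $\sigma_1,\dots,\sigma_{n-1}$. For $n\ge t>s\ge 1$ let $a_{ts}=(\sigma_{t-1}\cdots\sigma_{s+1})\,\sigma_s\,(\sigma_{t-1}\cdots\sigma_{s+1})^{-1}$ (the band generators), let $B_n^+\subset B_n$ be the submonoid they generate (the positive braids), and for $P\in B_n^+$ let $|P|$ be the length of any positive word in the $a_{ts}$ representing $P$. Put $\delta=\sigma_{n-1}\sigma_{n-2}\cdots\sigma_1$ and $\tau(W)=\delta^{-1}W\delta$. Write $V\le W$ if $W=P_1VP_2$ with $P_1,P_2\in B_n^+$. A canonical factor is a braid $A$ with $e\le A\le\delta$; its right complement is $\overline A=A^{-1}\delta$, so that $A\overline A=\delta$. For a canonical factor $A$ and $P\in B_n^+$ write $A\lceil P$ (the product $AP$ is left-weighted) if $|A|\ge|A'|$ for every decomposition $AP=A'P'$ with $A'$ a canonical factor and $P'\in B_n^+$. A left-canonical form of $W\in B_n$ is an expression $W=\delta^uA_1A_2\cdots A_k$ with $u\in\mathbb Z$, $k\ge 0$, each $A_i$ a canonical factor different from $e$ and $\delta$, and $A_i\lceil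 A_{i+1}$ for $1\le i<k$. (I) For all canonical factors $A,B$: $A\lceil B$ if and only if $\overline B\lceil\tau(\overline A)$. (II) If $W=\delta^uA_1A_2\cdots A_k$ is a left-canonical form of $W\in B_n$, then $$W^{-1}=\delta^{-(u+k)}\,\tau^{-(u+k)}(\overline{A_k})\cdots\tau^{-(u+1)}(\overline{A_1})$$ is a left-canonical form of $W^{-1}$, and it is the only one. -/

import Mathlib

namespace BandBraid

/-- Indices `1 ≤ i ≤ n - 1` of the Artin generators of the `n`-strand braid group. -/
abbrev ArtinIndex (n : ℕ) : Type := {i : ℕ // 1 ≤ i ∧ i < n}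

/-- Artin's relations: `σ i * σ j = σ j * σ i` if `|i - j| > 1`, and
`σ i * σ j * σ i = σ j * σ i * σ j` if `|i - j| = 1` (by symmetry it is enough to take `i < j`). -/
def artinRels (n : ℕ) : Set (FreeGroup (ArtinIndex n)) :=
  {r | ∃ i j : ArtinIndex n, (i : ℕ) + 1 < j ∧
      r = FreeGroup.of i * FreeGroup.of j * (FreeGroup.of j * FreeGroup.of i)⁻¹} ∪
  {r | ∃ i j : ArtinIndex n, (i : ℕ) + 1 = j ∧
      r = FreeGroup.of i * FreeGroup.of j * FreeGroup.of i *
        (FreeGroup.of j * FreeGroup.of i * FreeGroup.of j)⁻¹}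

/-- The braid group on `n` strands, by Artin's presentation. -/
abbrev BraidGroup (n : ℕ) : Type := PresentedGroup (artinRels n)

/-- The Artin generator `σ i` for `1 ≤ i < n` (and `1` for an index out of range). -/
def sigma (n i : ℕ) : BraidGroup n :=
  if h : 1 ≤ i ∧ i < n then PresentedGroup.of ⟨i, h⟩ else 1

/-- The descending product `σ (t-1) * σ (t-2) * ⋯ * σ s`. -/
def descProd (n t s : ℕ) : BraidGroup n :=
  ((List.Ico s t).reverse.map (sigma n)).prod

/-- The band generator
`a_{ts} = (σ (t-1) ⋯ σ (s+1)) * σ s * (σ (t-1) ⋯ σ (s+1))⁻¹`, meant for `1 ≤ s < t ≤ n`. -/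
def band (n t s : ℕ) : BraidGroup n :=
  descProd n t (s + 1) * sigma n s * (descProd n t (s + 1))⁻¹

/-- The set of band generators `a_{ts}`, `n ≥ t > s ≥ 1`. -/
def bandGenerators (n : ℕ) : Set (BraidGroup n) :=
  {a | ∃ t s : ℕ, 1 ≤ s ∧ s < t ∧ t ≤ n ∧ a = band n t s}

/-- The monoid of positive braids: the braids represented by a positive word in the band
generators. -/
def positiveBraids (n : ℕ) : Submonoid (BraidGroup n) :=
  Submonoid.closure (bandGenerators n)

/-- The fundamental braid `δ = σ (n-1) * σ (n-2) * ⋯ * σ 1`. -/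
def delta (n : ℕ) : BraidGroup n := descProd n n 1

/-- The relation `V ≤ W`: `W = P₁ * V * P₂` for some positive braids `P₁, P₂`. -/
def BraidLE {n : ℕ} (V W : BraidGroup n) : Prop :=
  ∃ P₁ ∈ positiveBraids n, ∃ P₂ ∈ positiveBraids n, W = P₁ * V * P₂

/-- A canonical factor is a braid `A` with `e ≤ A ≤ δ`. -/
def IsCanonicalFactor {n : ℕ} (A : BraidGroup n) : Prop :=
  BraidLE 1 A ∧ BraidLE A (delta n)

/-- The inner automorphism `τ(W) = δ⁻¹ * W * δ`. Its powers `τ ^ m`, `m : ℤ`, are taken in the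
group of automorphisms. -/
def tau (n : ℕ) : MulAut (BraidGroup n) := MulAut.conj (delta n)⁻¹

/-- The right complement of `A`: the braid `X` with `A * X = δ`. -/
def rightComplement {n : ℕ} (A : BraidGroup n) : BraidGroup n := A⁻¹ * delta n

/-- The word length `|P|` of a positive braid `P`: the length of a positive word in the band
generators that represents `P`. All such words have the same length, see `wordLength_eq`. -/
noncomputable def wordLength {n : ℕ} (P : BraidGroup n) : ℕ :=
  sInf {m | ∃ l : List (BraidGroup n), (∀ a ∈ l, a ∈ bandGenerators n) ∧ l.prod = P ∧ l.length = m}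

/-- The exponent sum of a braid. -/
def expSum (n : ℕ) : BraidGroup n →* Multiplicative ℤ :=
  PresentedGroup.toGroup (f := fun _ => Multiplicative.ofAdd (1 : ℤ)) (by
    rintro r (⟨i, j, -, rfl⟩ | ⟨i, j, -, rfl⟩) <;> simp)

theorem expSum_band {n : ℕ} {a : BraidGroup n} (ha : a ∈ bandGenerators n) :
    expSum n a = Multiplicative.ofAdd (1 : ℤ) := by
  obtain ⟨t, s, h1, h2, h3, rfl⟩ := ha
  have h : 1 ≤ s ∧ s < n := ⟨h1, by omega⟩
  simp [band, sigma, h, expSum, mul_comm]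

theorem expSum_prod {n : ℕ} (l : List (BraidGroup n)) (hl : ∀ a ∈ l, a ∈ bandGenerators n) :
    expSum n l.prod = Multiplicative.ofAdd (l.length : ℤ) := by
  induction l with
  | nil => simp
  | cons a l ih =>
    rw [List.prod_cons, map_mul, expSum_band (hl a (by simp)),
      ih (fun b hb => hl b (by simp [hb])), ← ofAdd_add]
    push_cast [List.length_cons]
    rw [add_comm]

/-- Every positive word in the band generators that represents `P` has length `|P|`. -/
theorem wordLength_eq {n : ℕ} {P : BraidGroup n} (l : List (BraidGroup n))
    (hl : ∀ a ∈ l, a ∈ bandGenerators n) (hP : l.prod = P) : wordLength P = l.length := by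
  obtain ⟨l', hl', hP', hm⟩ := Nat.sInf_mem (s := {m | ∃ l : List (BraidGroup n),
    (∀ a ∈ l, a ∈ bandGenerators n) ∧ l.prod = P ∧ l.length = m}) ⟨_, l, hl, hP, rfl⟩
  have h := (expSum_prod l' hl').symm.trans ((congrArg _ (hP'.trans hP.symm)).trans
    (expSum_prod l hl))
  have h2 : (l'.length : ℤ) = l.length := Multiplicative.ofAdd.injective h
  have h3 : l'.length = wordLength P := hm
  omega

/-- `A⌈P`: the decomposition `Q = A * P`, with `A` a canonical factor and `P` positive, is
left-weighted, i.e. `|A|` is maximal among all such decompositions of `Q`. -/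
def LeftWeighted {n : ℕ} (A P : BraidGroup n) : Prop :=
  IsCanonicalFactor A ∧ P ∈ positiveBraids n ∧
    ∀ A' P' : BraidGroup n, IsCanonicalFactor A' → P' ∈ positiveBraids n → A' * P' = A * P →
      wordLength A' ≤ wordLength A

/-- `W = δ ^ u * A₁ * A₂ * ⋯ * A_k` is a left-canonical form of `W`, where `As = [A₁, …, A_k]`:
each `A_i` is a canonical factor other than `e` and `δ`, and each adjacent pair is
left-weighted. -/
def IsLeftCanonicalForm {n : ℕ} (W : BraidGroup n) (u : ℤ) (As : List (BraidGroup n)) : Prop :=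
  W = delta n ^ u * As.prod ∧
    (∀ A ∈ As, IsCanonicalFactor A ∧ A ≠ 1 ∧ A ≠ delta n) ∧
    As.IsChain LeftWeighted

/-- The list `[τ^{-(u+k)}(Ā_k), …, τ^{-(u+1)}(Ā_1)]` built from `[A₁, …, A_k]`, where the bar is
the right complement. In `mapIdx` the factor `A_i` has position `i - 1`. -/
def inverseFactors {n : ℕ} (u : ℤ) (As : List (BraidGroup n)) : List (BraidGroup n) :=
  (As.mapIdx fun i A => (tau n ^ (-(u + ((i : ℤ) + 1)))) (rightComplement A)).reverse

end BandBraid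

/-! A canonical factor is determined by its permutation of the strands, and the permutations that
occur are the noncrossing ones: the divisors of the cycle `deltaPerm n` for the absolute length,
i.e. the codimension of the space of invariant functions. Prefixes for this length correspond to
refinement of cycles, so any two divisors have a meet. The length is invariant under conjugation;
hence the complement `x ↦ x⁻¹ * c` reverses the prefix order, and its square is conjugation by `c`,
the counterpart of `tau`.

For (I), `A⌈B` means that the complement of `A` and the factor `B` have no common prefix except `e`
(`leftWeighted_simpleBraid`, `weighted_iff`). For the pair of complements, the double complement of
`B` is `τ(B)`, so the condition is the same one moved by `τ`, with the two sides exchanged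
(`weighted_compl`).

For (II), `A⁻¹` is the right complement of `A` times `δ⁻¹`. Collecting the powers of `δ` on the left
gives the stated product, and (I) with the invariance under `τ` makes it left-weighted. Uniqueness
needs an invariant of braids: the braid group acts on infinite left-weighted streams of noncrossing
permutations with `δ` inverted (`streamHom`), and the canonical form can be read off from the image
of the constant stream `1` (`prod_perm_ofChain`, `canonical_unique`). The same action turns the
local meet condition into maximality among all decompositions.

Braids and permutations are linked by `liftUniqueBelow` (all reduced factorizations of a noncrossing
permutation give the same product of bands) and `IsCanonicalFactor.isNC_and_eq` (canonical factors
are such products). -/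

namespace BandBraid

/-! ### The prefix order of a conjugation invariant length -/

/-- A subadditive length function on a group which is invariant under conjugation. -/
structure ConjLength {P : Type*} [Group P] (len : P → ℕ) : Prop where
  one : len 1 = 0
  eq_one : ∀ x, len x = 0 → x = 1
  mul_le : ∀ x y, len (x * y) ≤ len x + len y
  comm : ∀ x y, len (x * y) = len (y * x)

/-- `x` is a prefix of `y` for the length `len`: `y = x * w` with `len y = len x + len w`. -/
def Prefix {P : Type*} [Group P] (len : P → ℕ) (x y : P) : Prop :=
  len x + len (x⁻¹ * y) = len y

namespace Prefix

variable {P : Type*} [Group P] {len : P → ℕ} {x y z w : P}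

theorem mul_iff : Prefix len x (x * w) ↔ len x + len w = len (x * w) := by
  simp [Prefix]

theorem refl (h : ConjLength len) (x : P) : Prefix len x x := by
  simp [Prefix, h.one]

theorem one_left (h : ConjLength len) (x : P) : Prefix len 1 x := by
  simp [Prefix, h.one]

theorem trans (h : ConjLength len) (hxy : Prefix len x y) (hyz : Prefix len y z) :
    Prefix len x z := by
  have h1 := h.mul_le (x⁻¹ * y) (y⁻¹ * z)
  have h2 := h.mul_le x (x⁻¹ * z)
  simp only [mul_assoc, mul_inv_cancel_left] at h1 h2
  unfold Prefix at *
  omega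

theorem antisymm (h : ConjLength len) (hxy : Prefix len x y) (hyx : Prefix len y x) : x = y := by
  have h1 : x⁻¹ * y = 1 := h.eq_one _ (by unfold Prefix at *; omega)
  exact inv_mul_eq_one.mp h1

theorem eq_one (h : ConjLength len) (hx : Prefix len x 1) : x = 1 :=
  antisymm h hx (one_left h x)

/-- Both sides say that `z` is the reduced product of `x`, `w` and the rest; subadditivity leaves no
slack in either splitting. -/
theorem mem_iff (h : ConjLength len) (hxz : Prefix len x z) :
    Prefix len w (x⁻¹ * z) ↔ Prefix len x (x * w) ∧ Prefix len (x * w) z := by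
  have h1 := h.mul_le x w
  have h2 := h.mul_le (x * w) (w⁻¹ * (x⁻¹ * z))
  simp only [mul_assoc, mul_inv_cancel_left] at h2
  unfold Prefix at *
  simp only [mul_inv_rev, mul_assoc, inv_mul_cancel_left]
  have h3 := h.mul_le w (w⁻¹ * (x⁻¹ * z))
  simp only [mul_inv_cancel_left] at h3
  constructor
  · intro h4
    constructor <;> omega
  · rintro ⟨h4, h5⟩
    omega

/-- The right factor of a reduced product is again a prefix. -/
theorem right (h : ConjLength len) (hx : Prefix len x z) : Prefix len (x⁻¹ * z) z := by
  unfold Prefix at *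
  -- Commuting the two factors under `len` exchanges the roles of left and right factor.
  have h1 := h.comm (x⁻¹ * z)⁻¹ z
  have h2 : z * (x⁻¹ * z)⁻¹ = x := by group
  rw [h1, h2]
  omega

theorem conj (h : ConjLength len) (g : P) (hx : Prefix len x y) :
    Prefix len (g⁻¹ * x * g) (g⁻¹ * y * g) := by
  have key : ∀ a : P, len (g⁻¹ * a * g) = len a := fun a => by
    rw [h.comm]; simp
  unfold Prefix at *
  have h1 : (g⁻¹ * x * g)⁻¹ * (g⁻¹ * y * g) = g⁻¹ * (x⁻¹ * y) * g := by group
  rw [h1, key, key, key, hx]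

/-- Inside `x⁻¹ * z`, the element `y⁻¹ * z` is what remains after the prefix `x⁻¹ * y`, and right
factors are prefixes. -/
theorem compl (h : ConjLength len) (hxy : Prefix len x y) (hyz : Prefix len y z) :
    Prefix len (y⁻¹ * z) (x⁻¹ * z) := by
  have h1 : Prefix len (x⁻¹ * y) (x⁻¹ * z) := by
    rw [mem_iff h (hxy.trans h hyz)]
    simpa using ⟨hxy, hyz⟩
  have h2 := h1.right h
  simpa using h2

end Prefix

/-! ### Garside intervals: complements, meets and joins -/

/-- An interval `[1, top]` of a group with a conjugation invariant length in which any two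
elements have a meet for the prefix order. -/
structure GarsideInterval (P : Type*) [Group P] where
  len : P → ℕ
  isLen : ConjLength len
  top : P
  inf : P → P → P
  inf_left : ∀ x y, Prefix len x top → Prefix len y top → Prefix len (inf x y) x
  inf_right : ∀ x y, Prefix len x top → Prefix len y top → Prefix len (inf x y) y
  le_inf : ∀ x y z, Prefix len x top → Prefix len y top → Prefix len z x → Prefix len z y →
    Prefix len z (inf x y)

namespace GarsideInterval

variable {P : Type*} [Group P] (E : GarsideInterval P)

/-- The prefix order of the interval. -/
def le (x y : P) : Prop := Prefix E.len x y

/-- The right complement of `x` in the interval. -/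
def compl (x : P) : P := x⁻¹ * E.top

variable {E} {x y z w k l a : P}

theorem le_refl (x : P) : E.le x x := Prefix.refl E.isLen x

theorem one_le (x : P) : E.le 1 x := Prefix.one_left E.isLen x

theorem le_trans (hxy : E.le x y) (hyz : E.le y z) : E.le x z := Prefix.trans E.isLen hxy hyz

theorem le_antisymm (hxy : E.le x y) (hyx : E.le y x) : x = y := Prefix.antisymm E.isLen hxy hyx

theorem eq_one (hx : E.le x 1) : x = 1 := Prefix.eq_one E.isLen hx

theorem le_inv_mul_iff (hxz : E.le x z) :
    E.le w (x⁻¹ * z) ↔ E.le x (x * w) ∧ E.le (x * w) z := Prefix.mem_iff E.isLen hxz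

theorem le_compl_iff (hx : E.le x E.top) :
    E.le w (E.compl x) ↔ E.le x (x * w) ∧ E.le (x * w) E.top := le_inv_mul_iff hx

theorem mul_le_mul (hx : E.le x (x * w)) (hy : E.le y w) : E.le x (x * y) ∧ E.le (x * y) (x * w) :=
  (le_inv_mul_iff hx).mp (by simpa using hy)

theorem le_of_mul_le_mul (hx : E.le x (x * y)) (hy : E.le (x * y) (x * w)) : E.le y w := by
  simpa using (le_inv_mul_iff (le_trans hx hy)).mpr ⟨hx, hy⟩

theorem right_le (hx : E.le x z) : E.le (x⁻¹ * z) z := Prefix.right E.isLen hx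

theorem right_le_mul (hx : E.le x (x * w)) : E.le w (x * w) := by
  simpa using right_le hx

theorem compl_le (hx : E.le x E.top) : E.le (E.compl x) E.top := right_le hx

theorem inv_mul_le_inv_mul (hxy : E.le x y) (hyz : E.le y z) : E.le (x⁻¹ * y) (x⁻¹ * z) :=
  (le_inv_mul_iff (le_trans hxy hyz)).mpr (by simpa using ⟨hxy, hyz⟩)

theorem conj_le (g : P) (h : E.le x y) : E.le (g⁻¹ * x * g) (g⁻¹ * y * g) :=
  Prefix.conj E.isLen g h

theorem compl_le_compl (hxy : E.le x y) (hy : E.le y E.top) : E.le (E.compl y) (E.compl x) :=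
  Prefix.compl E.isLen hxy hy

theorem inf_le_left (hx : E.le x E.top) (hy : E.le y E.top) : E.le (E.inf x y) x :=
  E.inf_left x y hx hy

theorem inf_le_right (hx : E.le x E.top) (hy : E.le y E.top) : E.le (E.inf x y) y :=
  E.inf_right x y hx hy

theorem le_inf_of (hx : E.le x E.top) (hy : E.le y E.top) (hzx : E.le z x) (hzy : E.le z y) :
    E.le z (E.inf x y) :=
  E.le_inf x y z hx hy hzx hzy

/-- Complementation reverses the order, so the join is the left complement of the meet of the right
complements. -/
theorem exists_sup (hx : E.le x E.top) (hy : E.le y E.top) :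
    ∃ j, E.le j E.top ∧ E.le x j ∧ E.le y j ∧
      ∀ z, E.le z E.top → E.le x z → E.le y z → E.le j z := by
  have hcx := compl_le hx
  have hcy := compl_le hy
  set m := E.inf (E.compl x) (E.compl y) with hm
  have hmx : E.le m (E.compl x) := inf_le_left hcx hcy
  have hmy : E.le m (E.compl y) := inf_le_right hcx hcy
  have hmt : E.le m E.top := le_trans hmx hcx
  -- The left complement is the right complement conjugated by the top element, hence also reverses
  -- the order.
  have left_compl : ∀ {u v}, E.le u v → E.le v E.top →
      E.le (E.top * v⁻¹) (E.top * u⁻¹) := fun {u v} huv hv => by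
    have h := conj_le E.top⁻¹ (compl_le_compl huv hv)
    simpa [compl, mul_assoc] using h
  have back : ∀ u, E.top * (E.compl u)⁻¹ = u := fun u => by simp [compl]
  refine ⟨E.top * m⁻¹, ?_, ?_, ?_, ?_⟩
  · simpa using left_compl (one_le m) hmt
  · simpa [back] using left_compl hmx hcx
  · simpa [back] using left_compl hmy hcy
  · intro z hz hxz hyz
    have h : E.le (E.compl z) m :=
      le_inf_of hcx hcy (compl_le_compl hxz hz) (compl_le_compl hyz hz)
    simpa [back] using left_compl h hmt

/-! ### Left multiplication of left-weighted streams -/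

/-- The part of `a` which is moved to the left when `k * a` is made left-weighted. -/
def moved (E : GarsideInterval P) (k a : P) : P := E.inf (E.compl k) a

theorem moved_le (hk : E.le k E.top) (ha : E.le a E.top) : E.le (E.moved k a) a :=
  inf_le_right (compl_le hk) ha

theorem moved_le_compl (hk : E.le k E.top) (ha : E.le a E.top) :
    E.le (E.moved k a) (E.compl k) :=
  inf_le_left (compl_le hk) ha

theorem le_mul_moved (hk : E.le k E.top) (ha : E.le a E.top) :
    E.le k (k * E.moved k a) ∧ E.le (k * E.moved k a) E.top :=
  (le_compl_iff hk).mp (moved_le_compl hk ha)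

theorem le_moved (hk : E.le k E.top) (ha : E.le a E.top) (h1 : E.le k (k * w))
    (h2 : E.le (k * w) E.top) (h3 : E.le w a) : E.le w (E.moved k a) :=
  le_inf_of (compl_le hk) ha ((le_compl_iff hk).mpr ⟨h1, h2⟩) h3

/-- What `k` takes from `l * moved l a` contains `l`, because `k * l` is in the interval; the rest
is a prefix of `a` that fits behind `k * l`, and the largest such prefix is `moved (k * l) a`. This
is the local form of associativity from which `act_mul` follows. -/
theorem moved_mul (hkl : E.le k (k * l)) (hkl' : E.le (k * l) E.top) (ha : E.le a E.top) :
    E.moved k (l * E.moved l a) = l * E.moved (k * l) a := by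
  have hk : E.le k E.top := le_trans hkl hkl'
  have hl : E.le l E.top := le_trans (right_le_mul hkl) hkl'
  obtain ⟨hx1, hx2⟩ := le_mul_moved hl ha
  obtain ⟨hz1, hz2⟩ := le_mul_moved hkl' ha
  have hza := moved_le hkl' ha
  have hxa := moved_le hl ha
  set x := E.moved l a with hx
  set z := E.moved (k * l) a with hz
  have hkz : E.le k (k * (l * z)) := by
    rw [← mul_assoc]; exact le_trans hkl hz1
  have hlz : E.le l (l * z) := by
    rw [mul_assoc k l z] at hz1
    exact le_of_mul_le_mul hkl hz1
  have hkz2 : E.le (k * (l * z)) E.top := by rwa [← mul_assoc]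
  have hlz2 : E.le (l * z) E.top := le_trans (right_le_mul hkz) hkz2
  have hzx : E.le z x := le_moved hl ha hlz hlz2 hza
  apply le_antisymm
  · have hlm : E.le l (E.moved k (l * x)) := le_moved hk hx2 hkl hkl' hx1
    have hm1 := moved_le hk hx2
    obtain ⟨hm2, hm3⟩ := le_mul_moved hk hx2
    set m := E.moved k (l * x) with hm
    obtain ⟨y, hy⟩ : ∃ y, m = l * y := ⟨l⁻¹ * m, by simp⟩
    rw [hy] at hlm hm1 hm2 hm3 ⊢
    have hyx : E.le y x := le_of_mul_le_mul hlm hm1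
    have hkly := mul_le_mul hm2 hlm
    have hyz : E.le y z := by
      refine le_moved hkl' ha ?_ ?_ (le_trans hyx hxa)
      · rw [mul_assoc]; exact hkly.2
      · rwa [mul_assoc]
    exact (mul_le_mul hlz hyz).2
  · exact le_moved hk hx2 hkz hkz2 (mul_le_mul hx1 hzx).2

/-- The carry after reading `i` entries of the stream `A`, starting with the carry `s`. -/
def carry (E : GarsideInterval P) (s : P) (A : ℕ → P) : ℕ → P
  | 0 => s
  | i + 1 => (E.moved (carry E s A i) (A i))⁻¹ * A i

/-- Left multiplication of a stream by `s`. -/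
def act (E : GarsideInterval P) (s : P) (A : ℕ → P) (i : ℕ) : P :=
  E.carry s A i * E.moved (E.carry s A i) (A i)

/-- A stream of elements of the interval whose adjacent entries are left-weighted. -/
def IsNormal (E : GarsideInterval P) (A : ℕ → P) : Prop :=
  ∀ i, E.le (A i) E.top ∧ E.moved (A i) (A (i + 1)) = 1

variable {A : ℕ → P} {s t : P}

theorem carry_le (hs : E.le s E.top) (hA : ∀ i, E.le (A i) E.top) (i : ℕ) :
    E.le (E.carry s A i) E.top := by
  induction i with
  | zero => exact hs
  | succ i ih => exact le_trans (right_le (moved_le ih (hA i))) (hA i)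

theorem act_le (hs : E.le s E.top) (hA : ∀ i, E.le (A i) E.top) (i : ℕ) :
    E.le (E.act s A i) E.top :=
  (le_mul_moved (carry_le hs hA i) (hA i)).2

/-- At every position the carry of `s * t` is the reduced product of the carries of `s` and `t`;
`moved_mul` propagates this from one entry to the next. -/
theorem carry_mul (hst : E.le s (s * t)) (hst' : E.le (s * t) E.top)
    (hA : ∀ i, E.le (A i) E.top) (i : ℕ) :
    E.le (E.carry s (E.act t A) i) (E.carry s (E.act t A) i * E.carry t A i) ∧
      E.carry s (E.act t A) i * E.carry t A i = E.carry (s * t) A i := by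
  have ht : E.le t E.top := le_trans (right_le_mul hst) hst'
  induction i with
  | zero => exact ⟨hst, rfl⟩
  | succ i ih =>
    obtain ⟨h1, h2⟩ := ih
    have hc := carry_le hst' hA i
    rw [← h2] at hc
    have hl := carry_le ht hA i
    have key := moved_mul h1 hc (hA i)
    have e1 : E.carry s (E.act t A) (i + 1) =
        (E.moved (E.carry s (E.act t A) i * E.carry t A i) (A i))⁻¹ * E.moved (E.carry t A i) (A i) := by
      simp only [carry, act] at key ⊢
      rw [key]; group
    have e2 : E.carry t A (i + 1) = (E.moved (E.carry t A i) (A i))⁻¹ * A i := rfl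
    have e3 : E.carry (s * t) A (i + 1) =
        (E.moved (E.carry s (E.act t A) i * E.carry t A i) (A i))⁻¹ * A i := by
      rw [h2]; rfl
    have hza := moved_le hc (hA i)
    have hxa := moved_le hl (hA i)
    obtain ⟨hz1, hz2⟩ := le_mul_moved hc (hA i)
    rw [e1, e2, e3]
    refine ⟨?_, by group⟩
    rw [show ∀ p q r : P, p⁻¹ * q * (q⁻¹ * r) = p⁻¹ * r from fun p q r => by group]
    refine inv_mul_le_inv_mul ?_ hxa
    rw [mul_assoc] at hz1 hz2
    have hlz : E.le (E.carry t A i) (E.carry t A i * _) := le_of_mul_le_mul h1 hz1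
    exact le_moved hl (hA i) hlz
      (le_trans (right_le_mul (le_trans h1 hz1)) hz2) hza

theorem act_mul (hst : E.le s (s * t)) (hst' : E.le (s * t) E.top)
    (hA : ∀ i, E.le (A i) E.top) : E.act s (E.act t A) = E.act (s * t) A := by
  funext i
  obtain ⟨h1, h2⟩ := carry_mul hst hst' hA i
  have hc := carry_le hst' hA i
  have key := moved_mul h1 (h2 ▸ hc) (hA i)
  rw [h2] at key
  rw [act, act, act, key, ← mul_assoc, h2]

/-- Something that could still move one place to the left would either contradict the normality of
`A` or the maximality of what the carry has already absorbed. -/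
theorem act_normal (hs : E.le s E.top) (hA : E.IsNormal A) : E.IsNormal (E.act s A) := by
  have hA' := fun i => (hA i).1
  intro i
  refine ⟨act_le hs hA' i, ?_⟩
  have hk := carry_le hs hA' i
  have hk' := carry_le hs hA' (i + 1)
  have hn := (hA i).2
  have hB := act_le hs hA' i
  have hB' := act_le hs hA' (i + 1)
  have hz1 := moved_le hB hB'
  obtain ⟨hz2, hz3⟩ := le_mul_moved hB hB'
  set z := E.moved (E.act s A i) (E.act s A (i + 1)) with hz
  obtain ⟨hx1, hx2⟩ := le_mul_moved hk (hA' i)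
  have hxa := moved_le hk (hA' i)
  obtain ⟨hx1', hx2'⟩ := le_mul_moved hk' (hA' (i + 1))
  have hxa' := moved_le hk' (hA' (i + 1))
  set x := E.moved (E.carry s A i) (A i) with hx
  have hcarry : A i = x * E.carry s A (i + 1) := by simp [carry, hx]
  have hact : E.act s A i = E.carry s A i * x := rfl
  have hact' : E.act s A (i + 1) = E.carry s A (i + 1) * E.moved (E.carry s A (i + 1)) (A (i + 1)) :=
    rfl
  set k := E.carry s A i
  set k' := E.carry s A (i + 1)
  set x' := E.moved k' (A (i + 1))
  rw [hact] at hz2 hz3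
  rw [hact'] at hz1 hB'
  have hxz : E.le x (x * z) ∧ E.le (x * z) E.top := by
    rw [mul_assoc] at hz2 hz3
    exact ⟨le_of_mul_le_mul hx1 hz2, le_trans (right_le_mul (le_trans hx1 hz2)) hz3⟩
  have hxtop : E.le x E.top := le_trans hxz.1 hxz.2
  -- The join of `z` and the carry `k'` is written `k' * y`. It still fits behind `x`, so `y` is a
  -- prefix of `A (i + 1)` that fits behind `A i = x * k'`. Normality of `A` forces `y = 1`, hence
  -- `z` is a prefix of `k'`.
  obtain ⟨j, hj, hzj, hkj, hmin⟩ := exists_sup (le_trans hz1 hB') hk'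
  obtain ⟨y, rfl⟩ : ∃ y, j = k' * y := ⟨k'⁻¹ * j, by simp⟩
  have hyx' : E.le y x' := le_of_mul_le_mul hkj (hmin _ hB' hz1 hx1')
  have hxj : E.le (k' * y) (E.compl x) :=
    hmin _ (compl_le hxtop) ((le_compl_iff hxtop).mpr hxz)
      ((le_compl_iff hxtop).mpr (by rw [← hcarry]; exact ⟨hxa, hA' i⟩))
  have hxj' := (le_compl_iff hxtop).mp hxj
  have hy1 : y = 1 := by
    apply eq_one (E := E)
    rw [← hn]
    refine le_moved (hA' i) (hA' _) ?_ ?_ (le_trans hyx' hxa')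
    · rw [hcarry, mul_assoc]
      exact (mul_le_mul hxj'.1 hkj).2
    · rw [hcarry, mul_assoc]
      exact hxj'.2
  rw [hy1, mul_one] at hzj
  -- Now `x * z` is a prefix of `A i` that fits behind `k`, and `x` is the largest such prefix.
  have h1 : E.le (x * z) x := by
    have hxk : E.le x (x * k') := hcarry ▸ hxa
    have hxzA : E.le (x * z) (A i) := by
      have h := (mul_le_mul hxk hzj).2
      rwa [← hcarry] at h
    refine le_moved hk (hA' i) ?_ ?_ hxzA
    · rw [← mul_assoc]; exact le_trans hx1 hz2
    · rw [← mul_assoc]; exact hz3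
  have h2 := le_antisymm h1 hxz.1
  simpa using h2

theorem moved_top (ha : E.le a E.top) : E.moved E.top a = 1 := by
  apply eq_one (E := E)
  have h := moved_le_compl (le_refl E.top) ha
  rwa [compl, inv_mul_cancel] at h

/-- Prepend an entry to a stream. -/
def cons (a : P) (A : ℕ → P) : ℕ → P
  | 0 => a
  | i + 1 => A i

theorem cons_normal (ha : E.le a E.top) (h : E.moved a (A 0) = 1) (hA : E.IsNormal A) :
    E.IsNormal (cons a A) := by
  rintro (_ | i)
  · exact ⟨ha, h⟩
  · exact hA i

/-- Nothing moves at any position, so each carry is simply the preceding entry. -/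
theorem act_eq_cons (h : E.moved a (A 0) = 1) (hA : E.IsNormal A) :
    E.act a A = cons a A := by
  have hc : ∀ i, E.carry a A i = cons a A i := by
    intro i
    induction i with
    | zero => rfl
    | succ i ih =>
      rw [carry, ih]
      cases i with
      | zero => simp [cons, h]
      | succ i => simp [cons, (hA i).2]
  funext i
  rw [act, hc]
  cases i with
  | zero => simp [cons, h]
  | succ i => simp [cons, (hA i).2]

theorem act_top (hA : E.IsNormal A) : E.act E.top A = cons E.top A :=
  act_eq_cons (moved_top (hA 0).1) hA

theorem le_act_zero (hs : E.le s E.top) (hA : E.IsNormal A) : E.le s (E.act s A 0) :=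
  (le_mul_moved hs (hA 0).1).1

end GarsideInterval

/-! ### Inverting the top element: an action by permutations -/

namespace GarsideInterval

variable {P : Type*} [Group P] (E : GarsideInterval P)

/-- Conjugation of `s` by the `u`-th power of the top element. -/
def twist (u : ℤ) (s : P) : P := (E.top ^ u)⁻¹ * s * E.top ^ u

/-- The normal streams. -/
abbrev NormalStream : Type _ := {A : ℕ → P // E.IsNormal A}

variable {E} {s t a : P} {A : ℕ → P}

theorem twist_le (u : ℤ) (hs : E.le s E.top) : E.le (E.twist u s) E.top := by
  have h := conj_le (E.top ^ u) hs
  have h1 : (E.top ^ u)⁻¹ * E.top * E.top ^ u = E.top := by group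
  rwa [h1] at h

theorem twist_mul (u : ℤ) (s t : P) : E.twist u (s * t) = E.twist u s * E.twist u t := by
  simp [twist, mul_assoc]

theorem twist_le_mul (u : ℤ) (hs : E.le s (s * t)) :
    E.le (E.twist u s) (E.twist u s * E.twist u t) := by
  have h := conj_le (E.top ^ u) hs
  rwa [← twist_mul]

theorem twist_add (u v : ℤ) (s : P) : E.twist (u + v) s = E.twist u (E.twist v s) := by
  simp only [twist]; group

theorem twist_top (u : ℤ) : E.twist u E.top = E.top := by
  simp only [twist]; group

/-- The stream `A` preceded by the top element. -/
def consTop (A : E.NormalStream) : E.NormalStream :=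
  ⟨cons E.top A.1, cons_normal (le_refl _) (moved_top (A.2 0).1) A.2⟩

theorem consTop_injective : Function.Injective (consTop (E := E)) := by
  intro A B h
  apply Subtype.ext
  funext i
  exact congrFun (congrArg Subtype.val h) (i + 1)

/-- Both sides are the action of `s`, its complement and `twist 1 s` in turn: the first two multiply
to the top element, and so do the last two. -/
theorem act_act_top (hs : E.le s E.top) (hA : E.IsNormal A) :
    E.act s (E.act E.top A) = E.act E.top (E.act (E.twist 1 s) A) := by
  have hA' := fun i => (hA i).1
  have ht := twist_le 1 hs
  have hc := compl_le hs
  have e1 : E.compl s * E.twist 1 s = E.top := by simp [compl, twist, mul_assoc]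
  have e2 : s * E.compl s = E.top := by simp [compl]
  have h1 : E.le (E.compl s) E.top := hc
  have h2 := act_mul (s := E.compl s) (t := E.twist 1 s) (by rw [e1]; exact hc)
    (by rw [e1]; exact le_refl _) hA'
  have h3 := act_mul (s := s) (t := E.compl s) (by rw [e2]; exact hs)
    (by rw [e2]; exact le_refl _) (act_le ht hA')
  rw [e1] at h2
  rw [e2] at h3
  rw [← h2, h3]

/-- Left multiplication of normal streams by an element of the interval. -/
def actNormal (s : P) (hs : E.le s E.top) (A : E.NormalStream) : E.NormalStream :=
  ⟨E.act s A.1, act_normal hs A.2⟩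

theorem actNormal_consTop (hs : E.le s E.top) (A : E.NormalStream) :
    actNormal s hs (consTop A) = consTop (actNormal (E.twist 1 s) (twist_le 1 hs) A) := by
  apply Subtype.ext
  have h := act_act_top hs A.2
  rw [act_top A.2, act_top (act_normal (twist_le 1 hs) A.2)] at h
  exact h

theorem actNormal_congr (h : s = t) (hs : E.le s E.top) (A : E.NormalStream) :
    actNormal s hs A = actNormal t (h ▸ hs) A := by
  subst h; rfl

theorem actNormal_iterate (m : ℕ) (hs : E.le s E.top) (A : E.NormalStream) :
    actNormal s hs (consTop^[m] A) = consTop^[m] (actNormal (E.twist m s) (twist_le m hs) A) := by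
  induction m generalizing s with
  | zero =>
    exact actNormal_congr (by simp [twist]) hs A
  | succ m ih =>
    rw [Function.iterate_succ_apply', Function.iterate_succ_apply', actNormal_consTop, ih]
    congr 2
    apply actNormal_congr
    rw [← twist_add]; push_cast; rfl

/-- `(u, A)` stands for the `u`-th power of the top element times the stream `A`. -/
instance streamSetoid (E : GarsideInterval P) : Setoid (ℤ × E.NormalStream) where
  -- The relation identifies `(u, consTop A)` with `(u + 1, A)`.
  r p q := ∃ a b : ℕ, p.1 - a = q.1 - b ∧ consTop^[a] p.2 = consTop^[b] q.2
  iseqv := by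
    refine ⟨fun p => ⟨0, 0, rfl, rfl⟩, fun ⟨a, b, h, h'⟩ => ⟨b, a, h.symm, h'.symm⟩, ?_⟩
    rintro p q r ⟨a, b, h1, h2⟩ ⟨a', b', h3, h4⟩
    refine ⟨a' + a, b + b', by push_cast; omega, ?_⟩
    rw [Function.iterate_add_apply, Function.iterate_add_apply, h2, ← h4,
      ← Function.iterate_add_apply, ← Function.iterate_add_apply, add_comm]

/-- Normal streams with the top element inverted. -/
def StreamQuot (E : GarsideInterval P) : Type _ := Quotient (streamSetoid E)

/-- The class of a power of the top element times a stream. -/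
def cls (u : ℤ) (A : E.NormalStream) : StreamQuot E := Quotient.mk _ (u, A)

theorem cls_eq_iff {u v : ℤ} {A B : E.NormalStream} :
    cls u A = cls v B ↔ ∃ a b : ℕ, u - a = v - b ∧ consTop^[a] A = consTop^[b] B :=
  Quotient.eq (r := streamSetoid E)

theorem cls_injective (u : ℤ) : Function.Injective (cls (E := E) u) := by
  intro A B h
  obtain ⟨a, b, h1, h2⟩ := cls_eq_iff.mp h
  obtain rfl : a = b := by omega
  exact (consTop_injective.iterate a) h2

theorem cls_consTop (u : ℤ) (A : E.NormalStream) : cls u (consTop A) = cls (u + 1) A :=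
  cls_eq_iff.mpr ⟨0, 1, by push_cast; ring, rfl⟩

/-- Left multiplication by an element of the interval. -/
def lmul (s : P) (hs : E.le s E.top) : StreamQuot E → StreamQuot E :=
  -- Passing `s` to the right of the `u`-th power of the top element conjugates it, whence the
  -- twist.
  Quotient.map (fun p => (p.1, actNormal (E.twist p.1 s) (twist_le _ hs) p.2)) (by
    rintro ⟨u, A⟩ ⟨v, B⟩ ⟨a, b, h1, h2⟩
    refine ⟨a, b, h1, ?_⟩
    have key : ∀ (w : ℤ) (m : ℕ) (C : E.NormalStream),
        consTop^[m] (actNormal (E.twist w s) (twist_le _ hs) C) =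
        actNormal (E.twist (w - m) s) (twist_le _ hs) (consTop^[m] C) := by
      intro w m C
      rw [actNormal_iterate]
      congr 1
      apply actNormal_congr
      rw [← twist_add]; congr 1; ring
    simp only at h1 h2 ⊢
    rw [key, key, h2]
    exact actNormal_congr (by rw [h1]) _ _)

theorem lmul_cls (hs : E.le s E.top) (u : ℤ) (A : E.NormalStream) :
    lmul s hs (cls u A) = cls u (actNormal (E.twist u s) (twist_le _ hs) A) := rfl

theorem exists_cls (x : StreamQuot E) : ∃ u A, x = cls u A := by
  obtain ⟨⟨u, A⟩, h⟩ := Quotient.exists_rep x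
  exact ⟨u, A, h.symm⟩

theorem lmul_lmul (hst : E.le s (s * t)) (h : E.le (s * t) E.top) (x : StreamQuot E) :
    lmul s (le_trans hst h) (lmul t (le_trans (right_le_mul hst) h) x) = lmul (s * t) h x := by
  obtain ⟨u, A, rfl⟩ := exists_cls x
  rw [lmul_cls, lmul_cls, lmul_cls]
  congr 1
  apply Subtype.ext
  have h1 := act_mul (twist_le_mul u hst) (by rw [← twist_mul]; exact twist_le u h)
    (fun i => (A.2 i).1)
  simpa only [actNormal, twist_mul] using h1

theorem lmul_top (u : ℤ) (A : E.NormalStream) : lmul E.top (le_refl _) (cls u A) = cls (u + 1) A := by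
  rw [lmul_cls, ← cls_consTop]
  congr 1
  apply Subtype.ext
  simp only [actNormal, consTop, twist_top, act_top A.2]

theorem lmul_congr (h : s = t) (hs : E.le s E.top) : lmul s hs = lmul t (h ▸ hs) := by
  subst h; rfl

theorem lmul_top_bijective : Function.Bijective (lmul E.top (le_refl E.top)) := by
  constructor
  · intro x y h
    obtain ⟨u, A, rfl⟩ := exists_cls x
    obtain ⟨v, B, rfl⟩ := exists_cls y
    rw [lmul_top, lmul_top] at h
    obtain ⟨a, b, h1, h2⟩ := cls_eq_iff.mp h
    exact cls_eq_iff.mpr ⟨a, b, by omega, h2⟩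
  · intro x
    obtain ⟨u, A, rfl⟩ := exists_cls x
    exact ⟨cls (u - 1) A, by rw [lmul_top, sub_add_cancel]⟩

/-- The top element is a reduced product with `s` as its last factor, and another with `s` as its
first factor. Since the top element acts bijectively, the former gives injectivity and the latter
surjectivity. -/
theorem lmul_bijective (hs : E.le s E.top) : Function.Bijective (lmul s hs) := by
  constructor
  · have e : (E.top * s⁻¹) * s = E.top := by simp
    have h1 : E.le (E.top * s⁻¹) E.top := by
      have h := conj_le E.top⁻¹ (compl_le hs)
      simpa [compl, mul_assoc] using h
    intro x y h
    have h2 : E.le (E.top * s⁻¹) (E.top * s⁻¹ * s) := by rw [e]; exact h1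
    have h3 : E.le (E.top * s⁻¹ * s) E.top := by rw [e]; exact le_refl _
    have hx := lmul_lmul h2 h3 x
    have hy := lmul_lmul h2 h3 y
    rw [h, hy, lmul_congr e] at hx
    exact (lmul_top_bijective.1 hx).symm
  · have e : s * E.compl s = E.top := by simp [compl]
    intro y
    obtain ⟨x, rfl⟩ := lmul_top_bijective.2 y
    have h2 : E.le s (s * E.compl s) := by rw [e]; exact hs
    have h3 : E.le (s * E.compl s) E.top := by rw [e]; exact le_refl _
    refine ⟨lmul _ (compl_le hs) x, ?_⟩
    rw [lmul_lmul h2 h3, lmul_congr e]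

open Classical in
/-- Left multiplication by an element of the interval, as a permutation. -/
noncomputable def perm (E : GarsideInterval P) (s : P) : Equiv.Perm (StreamQuot E) :=
  if hs : E.le s E.top then Equiv.ofBijective (lmul s hs) (lmul_bijective hs) else 1

theorem perm_apply (hs : E.le s E.top) (x : StreamQuot E) : E.perm s x = lmul s hs x := by
  simp [perm, hs]

theorem perm_mul (hst : E.le s (s * t)) (h : E.le (s * t) E.top) :
    E.perm s * E.perm t = E.perm (s * t) := by
  ext x
  rw [Equiv.Perm.mul_apply, perm_apply h, perm_apply (le_trans hst h),
    perm_apply (le_trans (right_le_mul hst) h), lmul_lmul hst h]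

/-- An idempotent of a group is trivial. -/
theorem perm_one : E.perm 1 = 1 := by
  have h := perm_mul (E := E) (s := 1) (t := 1) (one_le _) (by simpa using one_le E.top)
  simpa using h

theorem perm_top_zpow (u v : ℤ) (A : E.NormalStream) :
    (E.perm E.top ^ u) (cls v A) = cls (u + v) A := by
  induction u using Int.induction_on with
  | zero => simp
  | succ m ih =>
    rw [add_comm (m : ℤ) 1, zpow_add, Equiv.Perm.mul_apply, ih, zpow_one,
      perm_apply (le_refl _), lmul_top]
    congr 1; ring
  | pred m ih =>
    apply (E.perm E.top).injective
    rw [← Equiv.Perm.mul_apply, ← zpow_one_add, add_sub_cancel, ih, perm_apply (le_refl _),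
      lmul_top]
    congr 1; ring

/-! ### Reading a left-weighted list off its action -/

/-- The stream that starts with the entries of `l` and goes on with ones. -/
def ofList (l : List P) : ℕ → P := fun i => l.getD i 1

theorem ofList_cons (a : P) (l : List P) : ofList (a :: l) = cons a (ofList l) := by
  funext i
  cases i <;> simp [ofList, cons]

/-- Adjacent elements of the interval which are left-weighted. -/
def Weighted (E : GarsideInterval P) (a b : P) : Prop := E.moved a b = 1

theorem moved_self_one (ha : E.le a E.top) : E.moved a 1 = 1 :=
  eq_one (E := E) (moved_le ha (one_le _))

theorem ofList_normal (l : List P) (hl : ∀ a ∈ l, E.le a E.top) (hc : l.IsChain E.Weighted) :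
    E.IsNormal (ofList l) := by
  induction l with
  | nil =>
    intro i
    simpa [ofList] using ⟨one_le (E := E) _, moved_self_one (one_le (E := E) _)⟩
  | cons a l ih =>
    rw [ofList_cons]
    have ha : E.le a E.top := hl a (by simp)
    refine cons_normal ha ?_ (ih (fun b hb => hl b (by simp [hb])) hc.of_cons)
    cases l with
    | nil => exact moved_self_one ha
    | cons b l => exact (List.isChain_cons_cons.mp hc).1

/-- The normal stream of a left-weighted list. -/
def ofChain (l : List P) (hl : ∀ a ∈ l, E.le a E.top) (hc : l.IsChain E.Weighted) :
    E.NormalStream :=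
  ⟨ofList l, ofList_normal l hl hc⟩

theorem perm_cls_zero (hs : E.le s E.top) (A : E.NormalStream) :
    E.perm s (cls 0 A) = cls 0 (actNormal s hs A) := by
  rw [perm_apply hs, lmul_cls]
  congr 1
  exact actNormal_congr (by simp [twist]) _ _

/-- The constant stream `1` serves as base point. Its image under the product of a left-weighted
list displays that list, since each new factor is just put in front. -/
theorem prod_perm_ofChain (l : List P) (hl : ∀ a ∈ l, E.le a E.top) (hc : l.IsChain E.Weighted) :
    (l.map E.perm).prod (cls 0 (ofChain [] (by simp) .nil)) = cls 0 (ofChain l hl hc) := by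
  induction l with
  | nil => simp
  | cons a l ih =>
    have ha : E.le a E.top := hl a (by simp)
    have hl' : ∀ b ∈ l, E.le b E.top := fun b hb => hl b (by simp [hb])
    have hn := ofList_normal l hl' hc.of_cons
    rw [List.map_cons, List.prod_cons, Equiv.Perm.mul_apply, ih hl' hc.of_cons,
      perm_cls_zero ha]
    congr 1
    apply Subtype.ext
    have h0 : E.moved a (ofList l 0) = 1 := by
      cases l with
      | nil => exact moved_self_one ha
      | cons b l => exact (List.isChain_cons_cons.mp hc).1
    exact (act_eq_cons h0 hn).trans (ofList_cons a l).symm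

/-- No entry is `1`, so the padding marks where each list ends. -/
theorem ofList_injective {l l' : List P} (hl : ∀ a ∈ l, a ≠ 1) (hl' : ∀ a ∈ l', a ≠ 1)
    (h : ofList l = ofList l') : l = l' := by
  induction l generalizing l' with
  | nil =>
    cases l' with
    | nil => rfl
    | cons b l' =>
      have h0 := congrFun h 0
      exact absurd h0.symm (by simpa [ofList] using hl' b (by simp))
  | cons a l ih =>
    cases l' with
    | nil =>
      have h0 := congrFun h 0
      exact absurd h0 (by simpa [ofList] using hl a (by simp))
    | cons b l' =>
      rw [ofList_cons, ofList_cons] at h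
      have h0 : a = b := congrFun h 0
      have h1 : ofList l = ofList l' := funext fun i => congrFun h (i + 1)
      rw [h0, ih (fun a ha => hl a (by simp [ha])) (fun a ha => hl' a (by simp [ha])) h1]

theorem iterate_consTop_inj {A B : E.NormalStream} (hA : A.1 0 ≠ E.top) (hB : B.1 0 ≠ E.top)
    {m k : ℕ} (h : consTop^[m] A = consTop^[k] B) : m = k ∧ A = B := by
  induction m generalizing k with
  | zero =>
    cases k with
    | zero => exact ⟨rfl, h⟩
    | succ k =>
      rw [Function.iterate_succ_apply'] at h
      exact absurd (congrFun (congrArg Subtype.val h) 0) hA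
  | succ m ih =>
    cases k with
    | zero =>
      rw [Function.iterate_succ_apply'] at h
      exact absurd (congrFun (congrArg Subtype.val h) 0).symm hB
    | succ k =>
      rw [Function.iterate_succ_apply', Function.iterate_succ_apply'] at h
      obtain ⟨h1, h2⟩ := ih (consTop_injective h)
      exact ⟨by rw [h1], h2⟩

/-- The power of the top element and the list in a left-weighted expression are determined by the
permutation which the expression induces. -/
theorem canonical_unique (htop : E.top ≠ 1) {u v : ℤ} {l l' : List P}
    (hl : ∀ a ∈ l, E.le a E.top ∧ a ≠ 1 ∧ a ≠ E.top) (hc : l.IsChain E.Weighted)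
    (hl' : ∀ a ∈ l', E.le a E.top ∧ a ≠ 1 ∧ a ≠ E.top) (hc' : l'.IsChain E.Weighted)
    (h : E.perm E.top ^ u * (l.map E.perm).prod = E.perm E.top ^ v * (l'.map E.perm).prod) :
    u = v ∧ l = l' := by
  have h1 := congrArg (fun g => g (cls 0 (ofChain [] (by simp) .nil))) h
  simp only [Equiv.Perm.mul_apply] at h1
  rw [prod_perm_ofChain l (fun a ha => (hl a ha).1) hc,
    prod_perm_ofChain l' (fun a ha => (hl' a ha).1) hc', perm_top_zpow, perm_top_zpow] at h1
  obtain ⟨a, b, h2, h3⟩ := cls_eq_iff.mp h1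
  -- The stream of the empty list starts with the default `1`; this is where `htop` enters.
  have hne : ∀ k : List P, (∀ a ∈ k, E.le a E.top ∧ a ≠ 1 ∧ a ≠ E.top) → ofList k 0 ≠ E.top := by
    intro k hk
    cases k with
    | nil => simpa [ofList] using htop.symm
    | cons b k => simpa [ofList] using (hk b (by simp)).2.2
  obtain ⟨h4, h5⟩ := iterate_consTop_inj (hne l hl) (hne l' hl') h3
  refine ⟨by omega, ofList_injective (fun a ha => (hl a ha).2.1) (fun a ha => (hl' a ha).2.1)
    (congrArg Subtype.val h5)⟩

end GarsideInterval

open Equiv Equiv.Perm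

/-! ### The absolute length of a permutation -/

section AbsoluteLength

variable {α : Type*}

/-- The rational functions on `α` which are invariant under `x`. -/
def fixedFun (x : Perm α) : Submodule ℚ (α → ℚ) where
  carrier := {f | ∀ i, f (x i) = f i}
  add_mem' := by
    intro f g hf hg i
    simp only [Pi.add_apply, hf i, hg i]
  zero_mem' := fun _ => rfl
  smul_mem' := by
    intro a f hf i
    simp only [Pi.smul_apply, hf i]

theorem fixedFun_inf_le (x y : Perm α) : fixedFun x ⊓ fixedFun y ≤ fixedFun (x * y) := by
  rintro f ⟨hx, hy⟩ i
  rw [Perm.mul_apply, hx, hy]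

theorem fixedFun_eq_top {x : Perm α} (h : fixedFun x = ⊤) : x = 1 := by
  classical
  ext i
  have h1 : (Pi.single i 1 : α → ℚ) ∈ fixedFun x := h ▸ Submodule.mem_top
  have h2 := h1 i
  by_contra h3
  rw [Pi.single_eq_same, Pi.single_eq_of_ne (fun h => h3 (by simp [h]))] at h2
  exact zero_ne_one h2

variable [Fintype α]

/-- The absolute length of a permutation: the codimension of the space of invariant functions. -/
noncomputable def absLen (x : Perm α) : ℕ := Fintype.card α - Module.finrank ℚ (fixedFun x)

theorem absLen_add_finrank (x : Perm α) :
    absLen x + Module.finrank ℚ (fixedFun x) = Fintype.card α := by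
  have h := Submodule.finrank_le (fixedFun x)
  rw [Module.finrank_fintype_fun_eq_card] at h
  unfold absLen
  omega

theorem finrank_fixedFun_inf (x y : Perm α) :
    Module.finrank ℚ (fixedFun x) + Module.finrank ℚ (fixedFun y) ≤
      Module.finrank ℚ (fixedFun x ⊓ fixedFun y : Submodule ℚ (α → ℚ)) + Fintype.card α := by
  have h := Submodule.finrank_sup_add_finrank_inf_eq (fixedFun x) (fixedFun y)
  have h2 := Submodule.finrank_le (fixedFun x ⊔ fixedFun y)
  rw [Module.finrank_fintype_fun_eq_card] at h2
  omega

/-- Subadditivity is the dimension formula for the intersection of two invariant spaces. For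
symmetry, composition with `y` maps the invariants of `y * x` isomorphically onto those of `x * y`.
-/
theorem conjLength_absLen : ConjLength (absLen (α := α)) where
  one := by
    have h : fixedFun (1 : Perm α) = ⊤ := eq_top_iff.mpr fun f _ i => rfl
    have h1 := absLen_add_finrank (1 : Perm α)
    rw [h, finrank_top, Module.finrank_fintype_fun_eq_card] at h1
    omega
  eq_one x hx := by
    have h1 := absLen_add_finrank x
    apply fixedFun_eq_top
    apply Submodule.eq_top_of_finrank_eq
    rw [Module.finrank_fintype_fun_eq_card]
    omega
  mul_le x y := by
    have h1 := absLen_add_finrank x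
    have h2 := absLen_add_finrank y
    have h3 := absLen_add_finrank (x * y)
    have h4 := finrank_fixedFun_inf x y
    have h5 := Submodule.finrank_mono (fixedFun_inf_le x y)
    omega
  comm x y := by
    have key : (fixedFun (y * x)).map (LinearEquiv.funCongrLeft ℚ ℚ y).toLinearMap =
        fixedFun (x * y) := by
      ext f
      constructor
      · rintro ⟨g, hg, rfl⟩ i
        have h := hg (y i)
        simpa [LinearEquiv.funCongrLeft, LinearMap.funLeft] using h
      · intro hf
        refine ⟨f ∘ y.symm, fun i => ?_, ?_⟩
        · have h := hf (y.symm i)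
          simpa using h
        · ext i
          simp [LinearEquiv.funCongrLeft, LinearMap.funLeft]
    have h1 := absLen_add_finrank (x * y)
    have h2 := absLen_add_finrank (y * x)
    have h3 := LinearEquiv.finrank_map_eq (LinearEquiv.funCongrLeft ℚ ℚ y) (fixedFun (y * x))
    rw [key] at h3
    omega

theorem absLen_lt_of_fixedFun_lt {x y : Perm α} (h : fixedFun x < fixedFun y) :
    absLen y < absLen x := by
  have h1 := absLen_add_finrank x
  have h2 := absLen_add_finrank y
  have h3 := Submodule.finrank_lt_finrank_of_lt h
  omega

/-- Additivity of lengths is equality in the dimension estimate, so the invariants of `y` are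
exactly the common invariants of `x` and `x⁻¹ * y`. -/
theorem fixedFun_le_of_prefix {x y : Perm α} (h : Prefix absLen x y) :
    fixedFun y ≤ fixedFun x := by
  have h1 := absLen_add_finrank x
  have h2 := absLen_add_finrank y
  have h3 := absLen_add_finrank (x⁻¹ * y)
  have h4 := finrank_fixedFun_inf x (x⁻¹ * y)
  have h5 := fixedFun_inf_le x (x⁻¹ * y)
  rw [mul_inv_cancel_left] at h5
  have h6 : fixedFun x ⊓ fixedFun (x⁻¹ * y) = fixedFun y :=
    Submodule.eq_of_le_of_finrank_le h5 (by unfold Prefix at h; omega)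
  rw [← h6]
  exact inf_le_left

/-- On a finite set natural powers reach the whole cycle, so forward invariance of `p` is enough. -/
theorem SameCycle.iff_of_invariant {x : Perm α} {k l : α} (h : x.SameCycle k l) (p : α → Prop)
    (hp : ∀ m, p m → p (x m)) : p k ↔ p l := by
  have key : ∀ {a b}, x.SameCycle a b → p a → p b := by
    intro a b hab ha
    obtain ⟨n, rfl⟩ := hab.exists_nat_pow_eq
    clear hab
    induction n with
    | zero => exact ha
    | succ n ih =>
      rw [pow_succ', Perm.mul_apply]
      exact hp _ ih
  exact ⟨key h, key h.symm⟩

open Classical in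
theorem sameCycle_of_prefix {x y : Perm α} (h : Prefix absLen x y) {k l : α}
    (hkl : x.SameCycle k l) : y.SameCycle k l := by
  -- The indicator function of the cycle of `k` under `y` is invariant under `y`, hence under its
  -- prefix `x`.
  have h1 : (fun m => if y.SameCycle k m then (1 : ℚ) else 0) ∈ fixedFun y := fun i => by
    simp [sameCycle_apply_right]
  have h2 := fixedFun_le_of_prefix h h1
  refine (SameCycle.iff_of_invariant hkl (fun m => y.SameCycle k m) fun m hm => ?_).mp
    (SameCycle.refl _ _)
  have h3 := h2 m
  by_contra h4
  simp [hm, h4] at h3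

variable [DecidableEq α]

theorem absLen_swap_le (i j : α) : absLen (swap i j) ≤ 1 := by
  let φ : (α → ℚ) →ₗ[ℚ] ℚ :=
    LinearMap.proj (R := ℚ) (φ := fun _ : α => ℚ) i - LinearMap.proj (R := ℚ) (φ := fun _ : α => ℚ) j
  have h1 : LinearMap.ker φ ≤ fixedFun (swap i j) := by
    intro f hf m
    have hf' : f i = f j := by simpa [φ, sub_eq_zero] using hf
    rw [swap_apply_def]
    split_ifs with h2 h3
    · rw [h2, hf']
    · rw [h3, hf']
    · rfl
  have h2 := LinearMap.finrank_range_add_finrank_ker φ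
  have h3 := Submodule.finrank_le (LinearMap.range φ)
  have h4 := Submodule.finrank_mono h1
  have h5 := absLen_add_finrank (swap i j)
  rw [Module.finrank_fintype_fun_eq_card] at h2
  rw [Module.finrank_self] at h3
  omega

theorem absLen_swap {i j : α} (h : i ≠ j) : absLen (swap i j) = 1 := by
  have h1 := absLen_swap_le i j
  have h2 : absLen (swap i j) ≠ 0 := fun h0 =>
    h (swap_eq_one_iff.mp (conjLength_absLen.eq_one _ h0))
  omega

/-- Multiplying by `swap i (w i)` detaches `i` from its cycle. The indicator of `i` becomes a new
invariant function, so the length drops. -/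
theorem exists_swap_prefix {w : Perm α} (hw : w ≠ 1) :
    ∃ i j, i ≠ j ∧ Prefix absLen (swap i j) w := by
  obtain ⟨i, hi⟩ : ∃ i, w i ≠ i := by
    by_contra! h
    exact hw (Perm.ext h)
  refine ⟨i, w i, hi.symm, ?_⟩
  have hfix : (swap i (w i) * w) i = i := by simp
  have hlt : fixedFun w < fixedFun (swap i (w i) * w) := by
    rw [SetLike.lt_iff_le_and_exists]
    refine ⟨fun f hf m => ?_, Pi.single i 1, fun m => ?_, fun h => ?_⟩
    · rw [Perm.mul_apply, swap_apply_def]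
      split_ifs with h1 h2
      · rw [hf i, ← h1, hf m]
      · rw [w.injective h2]
      · exact hf m
    · by_cases hm : m = i
      · rw [hm, hfix]
      · have h1 : (swap i (w i) * w) m ≠ i := fun h =>
          hm ((swap i (w i) * w).injective (h.trans hfix.symm))
        rw [Pi.single_eq_of_ne h1, Pi.single_eq_of_ne hm]
    · have h1 := h i
      rw [Pi.single_eq_same, Pi.single_eq_of_ne hi] at h1
      exact zero_ne_one h1
  have h1 := absLen_lt_of_fixedFun_lt hlt
  have h2 := conjLength_absLen.mul_le (swap i (w i)) (swap i (w i) * w)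
  rw [swap_mul_self_mul] at h2
  have h3 := absLen_swap hi.symm
  rw [Prefix, swap_inv]
  omega

end AbsoluteLength

/-! ### Noncrossing permutations and refinement of cycles -/

section Noncrossing

variable {α : Type*} [Fintype α] [LinearOrder α]

/-- Noncrossing permutations whose cycles are decreasing: every step `i ↦ x i` down jumps over a
set which is invariant under `x`. -/
def IsNC (x : Perm α) : Prop := ∀ i k, x i < k → k < i → x i < x k ∧ x k < i

variable {x y : Perm α} {i j k l : α}

/-- The open interval between `x i` and `i` is invariant and misses `i`, hence contains no point of
its cycle: a downward step goes to the next lower member. -/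
theorem IsNC.le_apply (hx : IsNC x) (h : x.SameCycle i k) (hk : k < i) :
    k ≤ x i := by
  by_contra! hlt
  have h1 := (SameCycle.iff_of_invariant h (fun m => x i < m ∧ m < i)
    (fun m hm => hx i m hm.1 hm.2)).mpr ⟨hlt, hk⟩
  exact lt_irrefl _ h1.2

theorem IsNC.le_of_le_apply (hx : IsNC x) (h : x.SameCycle i k) (hi : i ≤ x i) : i ≤ k := by
  refine ((SameCycle.iff_of_invariant h (fun m => x.SameCycle i m ∧ i ≤ m) ?_).mp
    ⟨SameCycle.refl _ _, le_rfl⟩).2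
  rintro m ⟨h1, h2⟩
  refine ⟨sameCycle_apply_right.mpr h1, ?_⟩
  rcases lt_or_ge (x m) m with h3 | h3
  · rcases h2.eq_or_lt with rfl | h4
    · exact hi
    · exact hx.le_apply h1.symm h4
  · exact h2.trans h3

/-- A step that does not descend starts at the minimum of the cycle and ends at its maximum. -/
theorem IsNC.le_apply_of_le (hx : IsNC x) (h : x.SameCycle i k) (hi : i ≤ x i) : k ≤ x i := by
  refine ((SameCycle.iff_of_invariant h (fun m => x.SameCycle i m ∧ m ≤ x i) ?_).mp
    ⟨SameCycle.refl _ _, hi⟩).2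
  rintro m ⟨h1, h2⟩
  refine ⟨sameCycle_apply_right.mpr h1, ?_⟩
  rcases lt_or_ge (x m) m with h3 | h3
  · exact h3.le.trans h2
  · rw [le_antisymm (hx.le_of_le_apply h1.symm h3) (hx.le_of_le_apply h1 hi)]

theorem IsNC.apply_lt (hx : IsNC x) (h : x.SameCycle i k) (hk : k < i) : x i < i := by
  by_contra! h1
  exact absurd (hx.le_of_le_apply h h1) hk.not_ge

/-- On each cycle the permutation is forced: every member goes to the next lower one and the minimum
to the maximum. -/
theorem IsNC.ext (hx : IsNC x) (hy : IsNC y) (h : ∀ k l, x.SameCycle k l ↔ y.SameCycle k l) :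
    x = y := by
  ext i
  have hxi : x.SameCycle i (x i) := sameCycle_apply_right.mpr (SameCycle.refl _ _)
  have hyi : y.SameCycle i (y i) := sameCycle_apply_right.mpr (SameCycle.refl _ _)
  have hxy := (h _ _).mp hxi
  have hyx := (h _ _).mpr hyi
  rcases lt_or_ge (x i) i with h1 | h1
  · have h2 := hy.apply_lt hxy h1
    exact le_antisymm (hy.le_apply hxy h1) (hx.le_apply hyx h2)
  · have h2 : i ≤ y i := by
      by_contra! h2
      exact absurd (hx.apply_lt hyx h2) h1.not_gt
    exact le_antisymm (hy.le_apply_of_le hxy h2) (hx.le_apply_of_le hyx h1)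

theorem IsNC.noncrossing (hx : IsNC x) {a b c d : α} (hab : a < b) (hbc : b < c) (hcd : c < d)
    (hac : x.SameCycle a c) (hbd : x.SameCycle b d) : x.SameCycle a b := by
  -- The step from `e`, the lowest member of the cycle of `a` above `b`, jumps over `b`. It then
  -- jumps over the whole cycle of `b`, although `d` lies above `c` and thus above `e`.
  obtain ⟨e, ⟨h1, h2⟩, h3⟩ := Set.exists_min_image {e | x.SameCycle a e ∧ b < e} id
    (Set.toFinite _) ⟨c, hac, hbc⟩
  have h4 := hx.apply_lt h1.symm (hab.trans h2)
  by_contra hnab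
  have h5 : x.SameCycle a (x e) := sameCycle_apply_right.mpr h1
  have h6 : x e < b := by
    by_contra! h6
    rcases h6.eq_or_lt with rfl | h6
    · exact hnab h5
    · exact absurd (h3 _ ⟨h5, h6⟩) h4.not_ge
  have h7 := (SameCycle.iff_of_invariant hbd (fun m => x e < m ∧ m < e)
    (fun m hm => hx e m hm.1 hm.2)).mp ⟨h6, h2⟩
  exact absurd (h3 c ⟨hac, hbc⟩) (hcd.trans h7.2).not_ge

/-- The part of the cycle of `i` which `swap i j` splits off. -/
def SplitPart (x : Perm α) (i j k : α) : Prop := x.SameCycle i k ∧ i ≤ k ∧ k < j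

theorem IsNC.splitPart_apply (hx : IsNC x) (hij : i < j) (h : x.SameCycle i j)
    (hk : SplitPart x i j k) : SplitPart x i j ((x * swap i j) k) := by
  obtain ⟨h1, h2, h3⟩ := hk
  have hj := hx.apply_lt h.symm hij
  rcases eq_or_ne k i with rfl | hki
  · rw [Perm.mul_apply, swap_apply_left]
    exact ⟨sameCycle_apply_right.mpr h, hx.le_apply h.symm hij, hj⟩
  · have hik : i < k := lt_of_le_of_ne h2 hki.symm
    have hk := hx.apply_lt h1.symm hik
    rw [Perm.mul_apply, swap_apply_of_ne_of_ne hki h3.ne]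
    exact ⟨sameCycle_apply_right.mpr h1, hx.le_apply h1.symm hik, hk.trans h3⟩

theorem IsNC.split_left (hx : IsNC x) (hij : i < j) (h : x.SameCycle i j)
    (hk : SplitPart x i j k) : (x * swap i j).SameCycle i k := by
  induction k using (wellFounded_lt (α := α)).induction with
  | _ k ih =>
    obtain ⟨h1, h2, h3⟩ := hk
    rcases eq_or_ne k i with rfl | hki
    · exact SameCycle.refl _ _
    · have hik : i < k := lt_of_le_of_ne h2 hki.symm
      have h4 := hx.splitPart_apply hij h ⟨h1, h2, h3⟩
      have h5 : (x * swap i j) k < k := by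
        rw [Perm.mul_apply, swap_apply_of_ne_of_ne hki h3.ne]
        exact hx.apply_lt h1.symm hik
      exact sameCycle_apply_right.mp (ih _ h5 h4)

/-- The preimage of `k` under `x` lies above `k` and not above `i`, which allows a downward
induction; when it is `i` itself, the modified permutation reaches `k` directly from `j`. -/
theorem IsNC.split_right_of_lt (hx : IsNC x) (hij : i < j)
    (hk : x.SameCycle i k) (hki : k < i) : (x * swap i j).SameCycle j k := by
  induction k using (wellFounded_gt (α := α)).induction with
  | _ k ih =>
    have hxe : x (x.symm k) = k := x.apply_symm_apply k
    have hie : x.SameCycle i (x.symm k) := sameCycle_symm_apply_right.mpr hk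
    set e := x.symm k
    have he : k < e := by
      by_contra! hle
      have h1 := hx.le_apply_of_le hie.symm (by rw [hxe]; exact hle)
      rw [hxe] at h1
      exact absurd h1 hki.not_ge
    have hei : e ≤ i := by
      by_contra! hlt
      have h1 := hx.le_apply hie.symm hlt
      rw [hxe] at h1
      exact absurd h1 hki.not_ge
    rcases hei.eq_or_lt with hei | hei
    · have h1 : (x * swap i j) j = k := by rw [Perm.mul_apply, swap_apply_right, ← hei, hxe]
      rw [← h1]
      exact sameCycle_apply_right.mpr (SameCycle.refl _ _)
    · have h1 : (x * swap i j) e = k := by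
        rw [Perm.mul_apply, swap_apply_of_ne_of_ne hei.ne (hei.trans hij).ne, hxe]
      rw [← h1]
      exact sameCycle_apply_right.mpr (ih e he hie hei)

theorem IsNC.split_right_of_le (hx : IsNC x) (hij : i < j) (h : x.SameCycle i j)
    (hk : x.SameCycle i k) (hjk : j ≤ k) : (x * swap i j).SameCycle j k := by
  induction k using (wellFounded_lt (α := α)).induction with
  | _ k ih =>
    rcases hjk.eq_or_lt with rfl | hlt
    · exact SameCycle.refl _ _
    · have hk1 := hx.apply_lt hk.symm (hij.trans hlt)
      have h1 : (x * swap i j) k = x k := by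
        rw [Perm.mul_apply, swap_apply_of_ne_of_ne (hij.trans hlt).ne' hlt.ne']
      have h2 := ih (x k) hk1 (sameCycle_apply_right.mpr hk)
        (hx.le_apply (hk.symm.trans h) hlt)
      rw [← h1] at h2
      exact sameCycle_apply_right.mp h2

theorem split_other (h : x.SameCycle i j) (hk : ¬x.SameCycle i k) (hkl : x.SameCycle k l) :
    (x * swap i j).SameCycle k l := by
  refine ((SameCycle.iff_of_invariant hkl
    (fun m => (x * swap i j).SameCycle k m ∧ ¬x.SameCycle i m) ?_).mp
      ⟨SameCycle.refl _ _, hk⟩).1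
  rintro m ⟨h1, h2⟩
  have h3 : (x * swap i j) m = x m := by
    rw [Perm.mul_apply, swap_apply_of_ne_of_ne]
    · rintro rfl; exact h2 (SameCycle.refl _ _)
    · rintro rfl; exact h2 h
  refine ⟨?_, fun h4 => h2 (sameCycle_apply_right.mp h4)⟩
  rw [← h3]
  exact sameCycle_apply_right.mpr h1

theorem IsNC.split_sameCycle (hx : IsNC x) (hij : i < j) (h : x.SameCycle i j)
    (hkl : x.SameCycle k l) (hA : SplitPart x i j k ↔ SplitPart x i j l) :
    (x * swap i j).SameCycle k l := by
  by_cases hk : x.SameCycle i k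
  · have hl := hk.trans hkl
    have right : ∀ m, x.SameCycle i m → ¬SplitPart x i j m → (x * swap i j).SameCycle j m := by
      intro m hm hmA
      rcases lt_or_ge m i with h1 | h1
      · exact hx.split_right_of_lt hij hm h1
      · exact hx.split_right_of_le hij h hm (by
          by_contra! h2
          exact hmA ⟨hm, h1, h2⟩)
    by_cases hkA : SplitPart x i j k
    · exact (hx.split_left hij h hkA).symm.trans (hx.split_left hij h (hA.mp hkA))
    · exact (right k hk hkA).symm.trans (right l hl (fun hlA => hkA (hA.mpr hlA)))
  · exact split_other h hk hkl

theorem IsNC.split (hx : IsNC x) (hij : i < j) (h : x.SameCycle i j) : IsNC (x * swap i j) := by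
  have hj := hx.apply_lt h.symm hij
  have hij' := hx.le_apply h.symm hij
  have hyi : (x * swap i j) i = x j := by rw [Perm.mul_apply, swap_apply_left]
  have hyj : (x * swap i j) j = x i := by rw [Perm.mul_apply, swap_apply_right]
  have hy : ∀ k, k ≠ i → k ≠ j → (x * swap i j) k = x k := fun k h1 h2 => by
    rw [Perm.mul_apply, swap_apply_of_ne_of_ne h1 h2]
  intro p k h1 h2
  rcases eq_or_ne p i with rfl | hpi
  · rw [hyi] at h1
    exact absurd (h1.trans h2) hij'.not_gt
  rcases eq_or_ne p j with rfl | hpj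
  · rw [hyj] at h1 ⊢
    have hi : x i < i := by
      by_contra! h3
      exact absurd (hx.le_apply_of_le h h3) (h1.trans h2).not_ge
    rcases lt_trichotomy k i with h3 | rfl | h3
    · rw [hy k h3.ne (h3.trans hij).ne]
      have h4 := hx i k h1 h3
      exact ⟨h4.1, h4.2.trans hij⟩
    · rw [hyi]
      exact ⟨hi.trans_le hij', hj⟩
    · rw [hy k h3.ne' h2.ne]
      by_cases hik : x.SameCycle i k
      · have h4 := hx.apply_lt hik.symm h3
        exact ⟨hi.trans_le (hx.le_apply hik.symm h3), h4.trans h2⟩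
      -- A point `k` between `i` and `j` outside their cycle is enclosed by the step of `x` from the
      -- lowest cycle member above it.
      · obtain ⟨e, ⟨h5, h6⟩, h7⟩ := Set.exists_min_image {e | x.SameCycle i e ∧ k < e} id
          (Set.toFinite _) ⟨p, h, h2⟩
        have h8 := hx.apply_lt h5.symm (h3.trans h6)
        have h9 : x.SameCycle i (x e) := sameCycle_apply_right.mpr h5
        have h10 : x e < k := by
          by_contra! h10
          rcases h10.eq_or_lt with h11 | h11
          · exact hik (h11 ▸ h9)
          · exact absurd (h7 _ ⟨h9, h11⟩) h8.not_ge
        have h12 := hx e k h10 h6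
        have h13 := hx.le_apply h5.symm (h3.trans h6)
        exact ⟨hi.trans (h13.trans_lt h12.1), h12.2.trans_le (h7 p ⟨h, h2⟩)⟩
  · rw [hy p hpi hpj] at h1 ⊢
    rcases eq_or_ne k i with rfl | hki
    · rw [hyi]
      have h3 := (SameCycle.iff_of_invariant h (fun m => x p < m ∧ m < p)
        (fun m hm => hx p m hm.1 hm.2)).mp ⟨h1, h2⟩
      exact hx p j h3.1 h3.2
    rcases eq_or_ne k j with rfl | hkj
    · rw [hyj]
      have h3 := (SameCycle.iff_of_invariant h (fun m => x p < m ∧ m < p)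
        (fun m hm => hx p m hm.1 hm.2)).mpr ⟨h1, h2⟩
      exact hx p i h3.1 h3.2
    rw [hy k hki hkj]
    exact hx p k h1 h2

-- The swap splits one cycle in two, and the indicator of `SplitPart` is a new invariant function;
-- the length drops by exactly one.
open Classical in
theorem IsNC.split_prefix (hx : IsNC x) (hij : i < j) (h : x.SameCycle i j) :
    Prefix absLen (x * swap i j) x := by
  have hyx : ∀ m, x.SameCycle m ((x * swap i j) m) := by
    intro m
    rw [Perm.mul_apply, sameCycle_apply_right, swap_apply_def]
    split_ifs with h1 h2
    · rw [h1]; exact h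
    · rw [h2]; exact h.symm
    · exact SameCycle.refl _ _
  have hlt : fixedFun x < fixedFun (x * swap i j) := by
    rw [SetLike.lt_iff_le_and_exists]
    refine ⟨fun f hf m => ?_, fun m => if SplitPart x i j m then 1 else 0, fun m => ?_,
      fun hf => ?_⟩
    · exact ((SameCycle.iff_of_invariant (hyx m) (fun e => f e = f m)
        (fun e he => (hf e).trans he)).mp rfl)
    · have h1 := SameCycle.iff_of_invariant (x := x * swap i j) (k := m)
        (l := (x * swap i j) m) (sameCycle_apply_right.mpr (SameCycle.refl _ _)) _
        (fun e he => hx.splitPart_apply hij h he)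
      simp only [h1]
    · have h1 := (SameCycle.iff_of_invariant h
        (fun e => (if SplitPart x i j e then (1 : ℚ) else 0) = 1)
        (fun e he => (hf e).trans he)).mp (if_pos ⟨SameCycle.refl _ _, le_rfl, hij⟩)
      simp [SplitPart] at h1
  have h1 := absLen_lt_of_fixedFun_lt hlt
  have h2 := conjLength_absLen.mul_le (x * swap i j) (swap i j)
  have h3 : (x * swap i j)⁻¹ * x = swap i j := by
    rw [mul_inv_rev, swap_inv, mul_assoc, inv_mul_cancel, mul_one]
  rw [mul_swap_mul_self] at h2
  have h4 := absLen_swap hij.ne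
  rw [Prefix, h3]
  omega

/-- Induction on the distance to `c`: some `x * swap a b` is one step closer, and `x` arises from it
by splitting a cycle. -/
theorem IsNC.of_prefix {c : Perm α} (hc : IsNC c) (h : Prefix absLen x c) : IsNC x := by
  induction hm : absLen (x⁻¹ * c) using Nat.strong_induction_on generalizing x with
  | _ m ih =>
    by_cases hw : x⁻¹ * c = 1
    · rw [inv_mul_eq_one.mp hw]; exact hc
    · obtain ⟨a, b, hab, ht⟩ := exists_swap_prefix hw
      wlog hlt : a < b generalizing a b
      · exact this b a hab.symm (swap_comm a b ▸ ht) (lt_of_le_of_ne (not_lt.mp hlt) hab.symm)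
      obtain ⟨h1, h2⟩ := (Prefix.mem_iff conjLength_absLen h).mp ht
      have h3 := absLen_swap hab
      have h4 := Prefix.mul_iff.mp h1
      have h5 : IsNC (x * swap a b) := by
        refine ih _ ?_ h2 rfl
        unfold Prefix at h h2
        omega
      have h6 := h1.right conjLength_absLen
      rw [inv_mul_cancel_left] at h6
      have h7 : (x * swap a b).SameCycle a b := by
        apply sameCycle_of_prefix h6
        have h8 : swap a b a = b := swap_apply_left a b
        conv_rhs => rw [← h8]
        exact sameCycle_apply_right.mpr (SameCycle.refl _ _)
      have h8 := h5.split hlt h7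
      rwa [mul_swap_mul_self] at h8

/-- Cycles of `x` are split along cuts that separate no class of `r`, until they coincide with the
classes. Each split is a prefix with smaller length. -/
theorem IsNC.exists_prefix (hx : IsNC x) (r : Setoid α)
    (hr : ∀ a b c d, a < b → b < c → c < d → r a c → r b d → r a b)
    (hrx : ∀ k l, r k l → x.SameCycle k l) :
    ∃ z, Prefix absLen z x ∧ IsNC z ∧ ∀ k l, z.SameCycle k l ↔ r k l := by
  induction hm : absLen x using Nat.strong_induction_on generalizing x with
  | _ n ih =>
    by_cases hxr : ∀ k l, x.SameCycle k l → r k l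
    · exact ⟨x, Prefix.refl conjLength_absLen x, hx, fun k l => ⟨hxr k l, hrx k l⟩⟩
    suffices hs : ∃ i j, i < j ∧ x.SameCycle i j ∧
        ∀ k l, r k l → SplitPart x i j k → SplitPart x i j l by
      obtain ⟨i, j, hij, h, hA⟩ := hs
      have h1 := hx.split_prefix hij h
      have h2 : (x * swap i j)⁻¹ * x = swap i j := by
        rw [mul_inv_rev, swap_inv, mul_assoc, inv_mul_cancel, mul_one]
      have h3 := h1
      rw [Prefix, h2, absLen_swap hij.ne] at h3
      obtain ⟨z, h4, h5⟩ := ih (absLen (x * swap i j)) (by omega) (hx.split hij h)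
        (fun k l hkl => hx.split_sameCycle hij h (hrx k l hkl)
          ⟨hA k l hkl, hA l k (r.symm hkl)⟩) rfl
      exact ⟨z, h4.trans conjLength_absLen h1, h5⟩
    push Not at hxr
    obtain ⟨p, q, hpq, hnr⟩ := hxr
    -- In a cycle that is not a single class, `m` is the minimum and `k` the lowest member outside
    -- the class of `m`. If this class returns above `k`, first at `b`, the cut is `(k, b)`;
    -- otherwise the part from `m` up to `k` is precisely the class, and the cut is `(m, k)`.
    obtain ⟨m, hpm, hmin⟩ := Set.exists_min_image {e | x.SameCycle p e} id
      (Set.toFinite _) ⟨p, SameCycle.refl _ _⟩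
    have hne : ∃ e, x.SameCycle p e ∧ ¬r m e := by
      by_contra! h
      exact hnr (r.trans (r.symm (h p (SameCycle.refl _ _))) (h q hpq))
    obtain ⟨k, ⟨hpk, hmk⟩, hkmin⟩ := Set.exists_min_image {e | x.SameCycle p e ∧ ¬r m e} id
      (Set.toFinite _) hne
    have hmk' : m < k := lt_of_le_of_ne (hmin k hpk) (fun h => hmk (h ▸ r.refl m))
    have hcyc : ∀ {e}, r m e → x.SameCycle p e := fun he => SameCycle.trans hpm (hrx _ _ he)
    by_cases hb : ∃ b, r m b ∧ k < b
    · obtain ⟨b, ⟨hmb, hkb⟩, hbmin⟩ := Set.exists_min_image {b | r m b ∧ k < b} id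
        (Set.toFinite _) hb
      refine ⟨k, b, hkb, hpk.symm.trans (hcyc hmb), ?_⟩
      rintro l l' hll ⟨h1, h2, h3⟩
      have hml : ¬r m l := by
        intro h4
        rcases h2.eq_or_lt with rfl | h5
        · exact hmk h4
        · exact absurd (hbmin l ⟨h4, h5⟩) h3.not_ge
      have hml' : ¬r m l' := fun h4 => hml (r.trans h4 (r.symm hll))
      have hkl' : x.SameCycle k l' := h1.trans (hrx _ _ hll)
      refine ⟨hkl', hkmin l' ⟨SameCycle.trans hpk hkl', hml'⟩, ?_⟩
      by_contra! h4
      -- A class leaving the part at the upper end would cross the class of `m` in `m < l < b < l'`.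
      have h5 : b < l' := lt_of_le_of_ne h4 (fun h => hml' (h ▸ hmb))
      exact hml (hr m l b l' (hmk'.trans_le h2) h3 h5 hmb hll)
    · push Not at hb
      refine ⟨m, k, hmk', hpm.symm.trans hpk, ?_⟩
      rintro l l' hll ⟨h1, h2, h3⟩
      have hml : r m l := by
        by_contra h4
        exact absurd (hkmin l ⟨SameCycle.trans hpm h1, h4⟩) h3.not_ge
      have hml' := r.trans hml hll
      refine ⟨hrx _ _ hml', hmin l' (hcyc hml'), ?_⟩
      exact lt_of_le_of_ne (hb l' hml') (fun h => hmk (h ▸ hml'))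

/-- For noncrossing permutations, the prefix order is the refinement order of the cycles. -/
theorem IsNC.prefix_of_sameCycle (hx : IsNC x) (hy : IsNC y)
    (h : ∀ k, y.SameCycle k (x k)) : Prefix absLen x y := by
  have h' : ∀ k l, x.SameCycle k l → y.SameCycle k l := fun k l hkl =>
    (SameCycle.iff_of_invariant hkl (fun m => y.SameCycle k m)
      (fun m hm => SameCycle.trans hm (h m))).mp (SameCycle.refl _ _)
  obtain ⟨z, h1, h2, h3⟩ := hy.exists_prefix (SameCycle.setoid x)
    (fun a b c d => hx.noncrossing) h'
  rwa [hx.ext h2 (fun k l => (h3 k l).symm)]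

theorem IsNC.exists_inf {c : Perm α} (hc : IsNC c) (hx : Prefix absLen x c)
    (hy : Prefix absLen y c) : ∃ z, Prefix absLen z x ∧ Prefix absLen z y ∧
      ∀ w, Prefix absLen w x → Prefix absLen w y → Prefix absLen w z := by
  have hx' := hc.of_prefix hx
  have hy' := hc.of_prefix hy
  obtain ⟨z, h1, h2, h3⟩ := hx'.exists_prefix (SameCycle.setoid x ⊓ SameCycle.setoid y)
    (fun a b c d hab hbc hcd h1 h2 => ⟨hx'.noncrossing hab hbc hcd h1.1 h2.1,
      hy'.noncrossing hab hbc hcd h1.2 h2.2⟩) (fun k l h => h.1)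
  have step : ∀ (w : Perm α) k, w.SameCycle k (w k) := fun w k =>
    sameCycle_apply_right.mpr (SameCycle.refl _ _)
  refine ⟨z, h1, h2.prefix_of_sameCycle hy' (fun k => ((h3 _ _).mp (step z k)).2), ?_⟩
  intro w hwx hwy
  refine (hx'.of_prefix hwx).prefix_of_sameCycle h2 (fun k => (h3 _ _).mpr ?_)
  exact ⟨sameCycle_of_prefix hwx (step w k), sameCycle_of_prefix hwy (step w k)⟩

open Classical in
/-- The interval below a noncrossing permutation, with the prefix order of the absolute length. -/
noncomputable def ncInterval (c : Perm α) (hc : IsNC c) : GarsideInterval (Perm α) where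
  len := absLen
  isLen := conjLength_absLen
  top := c
  inf x y := if h : Prefix absLen x c ∧ Prefix absLen y c then (hc.exists_inf h.1 h.2).choose else 1
  inf_left x y hx hy := by
    rw [dif_pos ⟨hx, hy⟩]
    exact (hc.exists_inf hx hy).choose_spec.1
  inf_right x y hx hy := by
    rw [dif_pos ⟨hx, hy⟩]
    exact (hc.exists_inf hx hy).choose_spec.2.1
  le_inf x y z hx hy hzx hzy := by
    rw [dif_pos ⟨hx, hy⟩]
    exact (hc.exists_inf hx hy).choose_spec.2.2 z hzx hzy

end Noncrossing

/-! ### Relations between the band generators -/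

section BandRelations

variable {n : ℕ}

theorem sigma_commute {i j : ℕ} (h : i + 1 < j) : Commute (sigma n i) (sigma n j) := by
  by_cases hi : 1 ≤ i ∧ i < n
  · by_cases hj : 1 ≤ j ∧ j < n
    · have h1 := PresentedGroup.one_of_mem (rels := artinRels n)
        (Or.inl ⟨⟨i, hi⟩, ⟨j, hj⟩, h, rfl⟩)
      rw [map_mul, map_inv, mul_inv_eq_one] at h1
      rw [map_mul, map_mul] at h1
      rw [sigma, sigma, dif_pos hi, dif_pos hj]
      exact h1
    · simp [sigma, hj]
  · simp [sigma, hi]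

theorem sigma_braid {i : ℕ} (h1 : 1 ≤ i) (h2 : i + 1 < n) :
    sigma n i * sigma n (i + 1) * sigma n i = sigma n (i + 1) * sigma n i * sigma n (i + 1) := by
  have hi : 1 ≤ i ∧ i < n := ⟨h1, by omega⟩
  have hj : 1 ≤ i + 1 ∧ i + 1 < n := ⟨by omega, h2⟩
  have h := PresentedGroup.one_of_mem (rels := artinRels n)
    (Or.inr ⟨⟨i, hi⟩, ⟨i + 1, hj⟩, rfl, rfl⟩)
  rw [map_mul, map_inv, mul_inv_eq_one] at h
  simp only [map_mul] at h
  rw [sigma, sigma, dif_pos hi, dif_pos hj]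
  exact h

theorem descProd_self (t : ℕ) : descProd n t t = 1 := by simp [descProd]

theorem descProd_succ {t s : ℕ} (h : s ≤ t) :
    descProd n (t + 1) s = sigma n t * descProd n t s := by
  simp [descProd, List.Ico.succ_top h]

theorem descProd_mul {t s r : ℕ} (h1 : r ≤ s) (h2 : s ≤ t) :
    descProd n t s * descProd n s r = descProd n t r := by
  induction t, h2 using Nat.le_induction with
  | base => rw [descProd_self, one_mul]
  | succ t ht ih => rw [descProd_succ ht, descProd_succ (h1.trans ht), mul_assoc, ih]

theorem descProd_succ_self (s : ℕ) : descProd n (s + 1) s = sigma n s := by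
  rw [descProd_succ le_rfl, descProd_self, mul_one]

theorem descProd_eq_mul_sigma {t s : ℕ} (h : s < t) :
    descProd n t s = descProd n t (s + 1) * sigma n s := by
  rw [← descProd_mul (Nat.le_succ s) h, descProd_succ_self]

theorem commute_descProd {g : BraidGroup n} {t s : ℕ}
    (h : ∀ i, s ≤ i → i < t → Commute g (sigma n i)) : Commute g (descProd n t s) := by
  apply Commute.list_prod_right
  intro y hy
  simp only [List.mem_map, List.mem_reverse, List.Ico.mem] at hy
  obtain ⟨i, ⟨h1, h2⟩, rfl⟩ := hy
  exact h i h1 h2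

/-- Only the factors `sigma n (i + 1) * sigma n i` interact with the generator, by the braid
relation; the remaining ones commute with it. -/
theorem descProd_semiconj_sigma {t r i : ℕ} (h1 : 1 ≤ r) (h2 : t ≤ n) (h3 : r ≤ i)
    (h4 : i + 2 ≤ t) : SemiconjBy (descProd n t r) (sigma n (i + 1)) (sigma n i) := by
  have e : descProd n t r =
      descProd n t (i + 2) * (sigma n (i + 1) * sigma n i) * descProd n i r := by
    rw [← descProd_mul (s := i + 2) (by omega) h4, ← descProd_mul (t := i + 2) (s := i) h3 (by omega),
      descProd_succ (by omega), descProd_succ_self, mul_assoc]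
    simp only [mul_assoc]
  have c1 : SemiconjBy (descProd n i r) (sigma n (i + 1)) (sigma n (i + 1)) :=
    (commute_descProd fun j _ hj => (sigma_commute (by omega)).symm).symm
  have c2 : SemiconjBy (descProd n t (i + 2)) (sigma n i) (sigma n i) :=
    (commute_descProd fun j hj _ => sigma_commute (by omega)).symm
  have c3 : SemiconjBy (sigma n (i + 1) * sigma n i) (sigma n (i + 1)) (sigma n i) := by
    have h := sigma_braid (n := n) (i := i) (by omega) (by omega)
    rw [SemiconjBy, ← h, mul_assoc]
  rw [e]
  exact (c2.mul_left c3).mul_left c1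

theorem descProd_semiconj {t r' s r : ℕ} (h1 : 1 ≤ r') (h2 : t ≤ n) (h3 : r' ≤ r) (h4 : r ≤ s)
    (h5 : s < t) : SemiconjBy (descProd n t r') (descProd n (s + 1) (r + 1)) (descProd n s r) := by
  induction s, h4 using Nat.le_induction with
  | base => rw [descProd_self, descProd_self]; exact SemiconjBy.one_right _
  | succ s hs ih =>
    rw [descProd_succ (t := s + 1) (by omega), descProd_succ hs]
    exact (descProd_semiconj_sigma h1 h2 (by omega) (by omega)).mul_right (ih (by omega))

/-- Conjugation by `descProd n s (r + 1)`, and then by `Z`, which commutes with `sigma n r`, reduces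
this to the braid relation for `r` and `r + 1`. It is the extra input for `band_mul_band'`;
`band_mul_band` needs far commutation only. -/
theorem sigma_band_braid {s r : ℕ} (h1 : 1 ≤ r) (h2 : r < s) (h3 : s < n) :
    band n s r * sigma n s * band n s r = sigma n s * band n s r * sigma n s := by
  have hshift := descProd_semiconj (n := n) (t := s + 1) (r' := r + 1) (s := s) (r := r + 1)
    (by omega) (by omega) le_rfl (by omega) (by omega)
  rw [SemiconjBy, descProd_succ (by omega : r + 1 ≤ s)] at hshift
  have hZ : descProd n (s + 1) (r + 1) = descProd n (s + 1) (r + 1 + 1) * sigma n (r + 1) :=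
    descProd_eq_mul_sigma (by omega)
  rw [descProd_succ (by omega : r + 1 ≤ s)] at hZ
  have hbZ : Commute (sigma n r) (descProd n (s + 1) (r + 1 + 1)) :=
    commute_descProd fun i hi _ => sigma_commute (by omega)
  have hb := sigma_braid (n := n) (i := r) h1 (by omega)
  unfold band
  generalize descProd n (s + 1) (r + 1 + 1) = Z at *
  generalize descProd n s (r + 1) = Y at *
  generalize sigma n s = a at *
  generalize sigma n (r + 1) = b' at *
  generalize sigma n r = b at *
  have e : Y⁻¹ * a * Y = Z * b' * Z⁻¹ := by
    rw [← hZ, eq_mul_inv_iff_mul_eq, mul_assoc, mul_assoc, ← mul_assoc a, hshift,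
      inv_mul_cancel_left]
  have ea : a = Y * (Z * b' * Z⁻¹) * Y⁻¹ := by rw [← e]; group
  have key : b * (Z * b' * Z⁻¹) * b = Z * b' * Z⁻¹ * b * (Z * b' * Z⁻¹) := by
    have c1 : Z⁻¹ * b = b * Z⁻¹ := hbZ.symm.inv_left.eq
    calc b * (Z * b' * Z⁻¹) * b = b * Z * b' * (Z⁻¹ * b) := by group
      _ = Z * (b * b' * b) * Z⁻¹ := by rw [c1, hbZ.eq]; group
      _ = Z * b' * (b * Z⁻¹) * Z * b' * Z⁻¹ := by rw [hb]; group
      _ = _ := by rw [← c1]; group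
  rw [ea]
  calc Y * b * Y⁻¹ * (Y * (Z * b' * Z⁻¹) * Y⁻¹) * (Y * b * Y⁻¹)
      = Y * (b * (Z * b' * Z⁻¹) * b) * Y⁻¹ := by group
    _ = _ := by rw [key]; group

theorem band_mul_band {t s r : ℕ} (h2 : r < s) (h3 : s < t) :
    band n t s * band n s r = band n t r * band n t s := by
  have e : descProd n t (r + 1) = descProd n t (s + 1) * sigma n s * descProd n s (r + 1) := by
    rw [← descProd_eq_mul_sigma h3, descProd_mul (by omega) h3.le]
  have c1 : Commute (descProd n t (s + 1)) (descProd n s (r + 1)) :=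
    commute_descProd fun i _ hi => (commute_descProd fun j hj _ => sigma_commute (by omega)).symm
  have c2 : Commute (descProd n t (s + 1)) (sigma n r) :=
    (commute_descProd fun j hj _ => sigma_commute (by omega)).symm
  have c3 : Commute (descProd n t (s + 1))
      (descProd n s (r + 1) * sigma n r * (descProd n s (r + 1))⁻¹) :=
    (c1.mul_right c2).mul_right c1.inv_right
  unfold band
  rw [e]
  generalize descProd n t (s + 1) = X at *
  generalize descProd n s (r + 1) = Y at *
  rw [show X * sigma n s * X⁻¹ * (Y * sigma n r * Y⁻¹) =
    X * sigma n s * (X⁻¹ * (Y * sigma n r * Y⁻¹)) by group, c3.inv_left.eq]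
  group

theorem band_mul_band' {t s r : ℕ} (h1 : 1 ≤ r) (h2 : r < s) (h3 : s < t) (h4 : t ≤ n) :
    band n s r * band n t r = band n t s * band n s r := by
  have e : descProd n t (r + 1) = descProd n t (s + 1) * sigma n s * descProd n s (r + 1) := by
    rw [← descProd_eq_mul_sigma h3, descProd_mul (by omega) h3.le]
  have c1 : Commute (descProd n t (s + 1)) (descProd n s (r + 1)) :=
    commute_descProd fun i _ hi => (commute_descProd fun j hj _ => sigma_commute (by omega)).symm
  have c2 : Commute (descProd n t (s + 1)) (sigma n r) :=
    (commute_descProd fun j hj _ => sigma_commute (by omega)).symm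
  have c3 : Commute (descProd n t (s + 1)) (band n s r) :=
    (c1.mul_right c2).mul_right c1.inv_right
  have hb := sigma_band_braid (n := n) h1 h2 (by omega)
  have e2 : band n t r = descProd n t (s + 1) * sigma n s * band n s r *
      (descProd n t (s + 1) * sigma n s)⁻¹ := by
    simp only [band, e]; group
  have e3 : band n t s = descProd n t (s + 1) * sigma n s * (descProd n t (s + 1))⁻¹ := rfl
  rw [e2, e3]
  generalize band n s r = B at *
  generalize descProd n t (s + 1) = X at *
  generalize sigma n s = a at *
  calc B * (X * a * B * (X * a)⁻¹) = B * X * a * B * a⁻¹ * X⁻¹ := by group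
    _ = X * (B * a * B) * a⁻¹ * X⁻¹ := by rw [← c3.eq]; group
    _ = X * a * (B * X⁻¹) := by rw [hb]; group
    _ = _ := by rw [← c3.inv_left.eq]; group

theorem commute_band {g : BraidGroup n} {t s : ℕ} (hst : s < t)
    (h : ∀ i, s ≤ i → i < t → Commute g (sigma n i)) : Commute g (band n t s) := by
  have h1 : Commute g (descProd n t (s + 1)) :=
    commute_descProd fun i hi hi' => h i (by omega) hi'
  exact (h1.mul_right (h s le_rfl hst)).mul_right h1.inv_right

theorem band_commute_of_lt {t s r q : ℕ} (h1 : q < r) (h2 : r < s) (h3 : s < t) :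
    Commute (band n t s) (band n r q) :=
  commute_band h1 fun i _ hi => (commute_band h3 fun j hj _ => sigma_commute (by omega)).symm

/-- The band is a quotient of two descending products. Both carry `sigma n (i + 1)` to `sigma n i`,
so the two shifts cancel. -/
theorem band_commute_of_nested {t s r q : ℕ} (h0 : 1 ≤ s) (h1 : s < q) (h2 : q < r) (h3 : r < t)
    (h4 : t ≤ n) : Commute (band n t s) (band n r q) := by
  refine commute_band h2 fun i hi hi' => ?_
  have e : band n t s = descProd n t s * (descProd n t (s + 1))⁻¹ := by
    rw [descProd_eq_mul_sigma (by omega : s < t)]; rfl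
  have c1 := descProd_semiconj_sigma (n := n) (t := t) (r := s) (i := i) h0 h4 (by omega) (by omega)
  have c2 := descProd_semiconj_sigma (n := n) (t := t) (r := s + 1) (i := i) (by omega) h4
    (by omega) (by omega)
  rw [e]
  exact c1.mul_left c2.inv_symm_left

theorem band_succ (s : ℕ) : band n (s + 1) s = sigma n s := by
  simp [band, descProd_self]

end BandRelations

/-! ### Noncrossing products of two transpositions -/

section NoncrossingExamples

variable {α : Type*} [LinearOrder α] {i j k l r s t : α}

theorem isNC_swap (h : i < j) : IsNC (swap i j) := by
  intro a b h1 h2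
  simp only [swap_apply_def] at *
  grind

theorem isNC_triple (h1 : r < s) (h2 : s < t) : IsNC (swap s t * swap r s) := by
  intro a b h3 h4
  simp only [Perm.mul_apply, swap_apply_def] at *
  grind

theorem isNC_swap_mul_swap_of_lt (h1 : i < j) (h2 : j < k) (h3 : k < l) :
    IsNC (swap i j * swap k l) := by
  intro a b h4 h5
  simp only [Perm.mul_apply, swap_apply_def] at *
  grind

theorem isNC_swap_mul_swap_of_nested (h1 : i < k) (h2 : k < l) (h3 : l < j) :
    IsNC (swap i j * swap k l) := by
  intro a b h4 h5
  simp only [Perm.mul_apply, swap_apply_def] at *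
  grind

theorem swap_mul_swap (h1 : r < s) (h2 : s < t) :
    swap s t * swap r s = swap r t * swap s t := by
  ext a
  simp only [Perm.mul_apply, swap_apply_def]
  grind

theorem swap_mul_swap' (h1 : r < s) (h2 : s < t) :
    swap r s * swap r t = swap s t * swap r s := by
  ext a
  simp only [Perm.mul_apply, swap_apply_def]
  grind

theorem swap_commute (h1 : i ≠ k) (h2 : i ≠ l) (h3 : j ≠ k) (h4 : j ≠ l) :
    swap i j * swap k l = swap k l * swap i j := by
  ext a
  simp only [Perm.mul_apply, swap_apply_def]
  grind

theorem sameCycle_swap_apply {x : Perm α} (h : x.SameCycle i j) (k : α) :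
    x.SameCycle k (swap i j k) := by
  rw [swap_apply_def]
  split_ifs with h1 h2
  · rw [h1]; exact h
  · rw [h2]; exact h.symm
  · exact SameCycle.refl _ _

theorem sameCycle_swap_mul_swap_apply {x : Perm α} (h : x.SameCycle i j) (h' : x.SameCycle k l)
    (m : α) : x.SameCycle m ((swap i j * swap k l) m) :=
  (sameCycle_swap_apply h' m).trans (sameCycle_swap_apply h _)

theorem sameCycle_triple (h1 : r < s) (h2 : s < t) :
    (swap s t * swap r s).SameCycle s t ∧ (swap s t * swap r s).SameCycle r s := by
  have step : ∀ k, (swap s t * swap r s).SameCycle k ((swap s t * swap r s) k) := fun k =>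
    sameCycle_apply_right.mpr (SameCycle.refl _ _)
  have e1 : (swap s t * swap r s) t = s := by
    rw [Perm.mul_apply, swap_apply_of_ne_of_ne (h1.trans h2).ne' h2.ne', swap_apply_right]
  have e2 : (swap s t * swap r s) s = r := by
    rw [Perm.mul_apply, swap_apply_right, swap_apply_of_ne_of_ne h1.ne (h1.trans h2).ne]
  have hts := step t
  have hsr := step s
  rw [e1] at hts
  rw [e2] at hsr
  exact ⟨hts.symm, hsr.symm⟩

theorem sameCycle_swap_mul_swap (h1 : i ≠ k) (h2 : i ≠ l) :
    (swap i j * swap k l).SameCycle i j := by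
  have h : (swap i j * swap k l).SameCycle i ((swap i j * swap k l) i) :=
    sameCycle_apply_right.mpr (SameCycle.refl _ _)
  rwa [Perm.mul_apply, swap_apply_of_ne_of_ne h1 h2, swap_apply_left] at h

variable [Fintype α]

theorem IsNC.swap_prefix_iff {x : Perm α} (hx : IsNC x) (h : i < j) :
    Prefix absLen (swap i j) x ↔ x.SameCycle i j := by
  constructor
  · intro h1
    refine sameCycle_of_prefix h1 ?_
    have h2 : (swap i j).SameCycle i (swap i j i) := sameCycle_apply_right.mpr (SameCycle.refl _ _)
    rwa [swap_apply_left] at h2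
  · intro h1
    exact (isNC_swap h).prefix_of_sameCycle hx (sameCycle_swap_apply h1)

end NoncrossingExamples

/-! ### Lifting noncrossing permutations to products of bands -/

/-- A family of elements of a group that satisfies the relations between the band generators. -/
structure IsBandFamily {α G : Type*} [LinearOrder α] [Group G] (b : α → α → G) : Prop where
  triple : ∀ {r s t}, r < s → s < t → b s t * b r s = b r t * b s t
  triple' : ∀ {r s t}, r < s → s < t → b r s * b r t = b s t * b r s
  comm_of_lt : ∀ {i j k l}, i < j → j < k → k < l → Commute (b i j) (b k l)
  comm_of_nested : ∀ {i j k l}, i < k → k < l → l < j → Commute (b i j) (b k l)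

section Lift

variable {α G : Type*} [Fintype α] [LinearOrder α] [Group G] (b : α → α → G)

/-- `IsLift b x g`: the element `g` is the product of the bands along a reduced factorization of
`x` into transpositions. -/
inductive IsLift : Perm α → G → Prop
  | one : IsLift 1 1
  | mul {i j : α} {x : Perm α} {g : G} (hij : i < j)
      (h : Prefix absLen (swap i j) (swap i j * x)) (hx : IsLift x g) :
      IsLift (swap i j * x) (b i j * g)

variable {b} {x y u : Perm α} {i j k l p q r s t : α} {g g' : G}

theorem IsLift.exists_eq (h : IsLift b x g) : (x = 1 ∧ g = 1) ∨
    ∃ i j g', i < j ∧ Prefix absLen (swap i j) x ∧ IsLift b (swap i j * x) g' ∧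
      g = b i j * g' := by
  cases h with
  | one => exact Or.inl ⟨rfl, rfl⟩
  | mul hij h hx =>
    refine Or.inr ⟨_, _, _, hij, h, ?_, rfl⟩
    rwa [swap_mul_self_mul]

theorem absLen_swap_mul (hij : i < j) (h : Prefix absLen (swap i j) x) :
    absLen (swap i j * x) + 1 = absLen x := by
  rw [Prefix, swap_inv, absLen_swap hij.ne] at h
  omega

theorem exists_isLift (b : α → α → G) (x : Perm α) : ∃ g, IsLift b x g := by
  induction hm : absLen x using Nat.strong_induction_on generalizing x with
  | _ m ih =>
    by_cases hx : x = 1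
    · exact ⟨1, hx ▸ .one⟩
    · obtain ⟨i, j, hij, h⟩ := exists_swap_prefix hx
      wlog hlt : i < j generalizing i j
      · exact this j i hij.symm (swap_comm i j ▸ h) (lt_of_le_of_ne (not_lt.mp hlt) hij.symm)
      obtain ⟨g, hg⟩ := ih _ (by have := absLen_swap_mul hlt h; omega) (swap i j * x) rfl
      refine ⟨b i j * g, ?_⟩
      have h1 := IsLift.mul hlt (by rwa [swap_mul_self_mul]) hg
      rwa [swap_mul_self_mul] at h1

/-- A lift of a permutation along some reduced factorization. -/
noncomputable def lift (b : α → α → G) (x : Perm α) : G := (exists_isLift b x).choose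

theorem isLift_lift (b : α → α → G) (x : Perm α) : IsLift b x (lift b x) :=
  (exists_isLift b x).choose_spec

/-- The lift of `x` along a reduced factorization which begins with `swap i j`. -/
noncomputable def liftVia (b : α → α → G) (x : Perm α) (i j : α) : G :=
  b i j * lift b (swap i j * x)

/-- Lifts of noncrossing permutations of length less than `m` are unique. -/
def LiftUniqueBelow (b : α → α → G) (m : ℕ) : Prop :=
  ∀ (y : Perm α) (g g' : G), IsNC y → absLen y < m → IsLift b y g → IsLift b y g' → g = g'

/-- Uniqueness for shorter permutations lets the second letter be chosen freely. Two first letters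
that begin the same `u` of length two are then compared by a single band relation. -/
theorem liftVia_eq (hu : LiftUniqueBelow b (absLen x)) (hx : IsNC x) (hij : i < j) (hpq : p < q)
    (h : u = swap i j * swap p q) (hiu : Prefix absLen (swap i j) u) (hux : Prefix absLen u x) :
    liftVia b x i j = b i j * b p q * lift b (u⁻¹ * x) := by
  have hix := hiu.trans conjLength_absLen hux
  have h1 : Prefix absLen (swap p q) (swap i j * x) := by
    have h2 := (Prefix.mem_iff conjLength_absLen (w := swap p q) hix).mpr ⟨h ▸ hiu, h ▸ hux⟩
    rwa [swap_inv] at h2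
  have e : swap p q * (u⁻¹ * x) = swap i j * x := by
    rw [h, mul_inv_rev, swap_inv, swap_inv]
    simp only [mul_assoc, swap_mul_self_mul]
  have h2 := IsLift.mul (b := b) hpq (by rwa [e]) (isLift_lift b (u⁻¹ * x))
  rw [e] at h2
  have h3 : IsNC (swap i j * x) := by
    have h4 := hix.right conjLength_absLen
    rw [swap_inv] at h4
    exact hx.of_prefix h4
  rw [liftVia, hu _ _ _ h3 (by have := absLen_swap_mul hij hix; omega) (isLift_lift b _) h2,
    mul_assoc]

theorem liftVia_triple (hb : IsBandFamily b) (hu : LiftUniqueBelow b (absLen x)) (hx : IsNC x)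
    (h1 : r < s) (h2 : s < t) (hrs : x.SameCycle r s) (hst : x.SameCycle s t) :
    liftVia b x s t = liftVia b x r t ∧ liftVia b x r s = liftVia b x r t := by
  have hu' := isNC_triple h1 h2
  have hux : Prefix absLen (swap s t * swap r s) x :=
    hu'.prefix_of_sameCycle hx (sameCycle_swap_mul_swap_apply hst hrs)
  obtain ⟨hts, hsr⟩ := sameCycle_triple h1 h2
  have a1 := liftVia_eq hu hx h2 h1 rfl ((hu'.swap_prefix_iff h2).mpr hts) hux
  have a2 := liftVia_eq hu hx (h1.trans h2) h2 (swap_mul_swap h1 h2)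
    ((hu'.swap_prefix_iff (h1.trans h2)).mpr (hsr.trans hts)) hux
  have a3 := liftVia_eq hu hx h1 (h1.trans h2) (swap_mul_swap' h1 h2).symm
    ((hu'.swap_prefix_iff h1).mpr hsr) hux
  rw [a1, a2, a3, hb.triple h1 h2, hb.triple' h1 h2, hb.triple h1 h2]
  exact ⟨rfl, rfl⟩

theorem liftVia_comm (hu : LiftUniqueBelow b (absLen x)) (hx : IsNC x)
    (hij : i < j) (hkl : k < l) (hnc : IsNC (swap i j * swap k l)) (hcomm : Commute (b i j) (b k l))
    (h1 : i ≠ k) (h2 : i ≠ l) (h3 : j ≠ k) (h4 : j ≠ l)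
    (hxij : x.SameCycle i j) (hxkl : x.SameCycle k l) :
    liftVia b x i j = liftVia b x k l := by
  have hux : Prefix absLen (swap i j * swap k l) x :=
    hnc.prefix_of_sameCycle hx (sameCycle_swap_mul_swap_apply hxij hxkl)
  have hk : (swap i j * swap k l).SameCycle k l := by
    rw [swap_commute h1 h2 h3 h4]
    exact sameCycle_swap_mul_swap h1.symm h3.symm
  rw [liftVia_eq hu hx hij hkl rfl ((hnc.swap_prefix_iff hij).mpr (sameCycle_swap_mul_swap h1 h2)) hux,
    liftVia_eq hu hx hkl hij (swap_commute h1 h2 h3 h4) ((hnc.swap_prefix_iff hkl).mpr hk) hux,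
    hcomm.eq]

/-- One endpoint is changed at a time, within a triple of the common cycle, until both pairs reach
the smaller lower and the larger upper endpoint. -/
theorem liftVia_eq_of_sameCycle (hb : IsBandFamily b) (hu : LiftUniqueBelow b (absLen x))
    (hx : IsNC x) (hij : i < j) (hkl : k < l) (hxij : x.SameCycle i j) (hxkl : x.SameCycle k l)
    (hxik : x.SameCycle i k) : liftVia b x i j = liftVia b x k l := by
  have right : ∀ {p q q'}, p < q → q ≤ q' → x.SameCycle p q → x.SameCycle q q' →
      liftVia b x p q = liftVia b x p q' := by
    intro p q q' h1 h2 h3 h4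
    rcases h2.eq_or_lt with rfl | h2
    · rfl
    · exact (liftVia_triple hb hu hx h1 h2 h3 h4).2
  have left : ∀ {p p' q}, p' ≤ p → p < q → x.SameCycle p' p → x.SameCycle p q →
      liftVia b x p q = liftVia b x p' q := by
    intro p p' q h1 h2 h3 h4
    rcases h1.eq_or_lt with rfl | h1
    · rfl
    · exact (liftVia_triple hb hu hx h1 h2 h3 h4).1
  have hxjl : x.SameCycle j l := (hxij.symm.trans hxik).trans hxkl
  rcases le_total i k with h1 | h1 <;> rcases le_total j l with h2 | h2
  · rw [right hij h2 hxij hxjl, left h1 hkl hxik hxkl]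
  · rw [left h1 hkl hxik hxkl, right (h1.trans_lt hkl) h2 (hxik.trans hxkl) hxjl.symm]
  · rw [right hij h2 hxij hxjl, left h1 (hij.trans_le h2) hxik.symm (hxij.trans hxjl)]
  · rw [right hkl h2 hxkl hxjl.symm, left h1 hij hxik.symm hxij]

theorem liftVia_eq_liftVia (hb : IsBandFamily b) (hu : LiftUniqueBelow b (absLen x))
    (hx : IsNC x) (hij : i < j) (hkl : k < l) (hxij : x.SameCycle i j) (hxkl : x.SameCycle k l) :
    liftVia b x i j = liftVia b x k l := by
  by_cases hxik : x.SameCycle i k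
  · exact liftVia_eq_of_sameCycle hb hu hx hij hkl hxij hxkl hxik
  wlog hik : i < k generalizing i j k l
  · refine (this hkl hij hxkl hxij (fun h => hxik h.symm) (lt_of_le_of_ne (not_lt.mp hik) ?_)).symm
    rintro rfl
    exact hxik (SameCycle.refl _ _)
  have hil : i ≠ l := (hik.trans hkl).ne
  have hjk : j ≠ k := by rintro rfl; exact hxik hxij
  have hjl : j ≠ l := by rintro rfl; exact hxik (hxij.trans hxkl.symm)
  rcases lt_or_gt_of_ne hjk with h1 | h1
  · exact liftVia_comm hu hx hij hkl (isNC_swap_mul_swap_of_lt hij h1 hkl)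
      (hb.comm_of_lt hij h1 hkl) hik.ne hil hjk hjl hxij hxkl
  rcases lt_or_gt_of_ne hjl with h2 | h2
  -- Two crossing pairs would have to lie in one cycle.
  · exact absurd (hx.noncrossing hik h1 h2 hxij hxkl) hxik
  · exact liftVia_comm hu hx hij hkl (isNC_swap_mul_swap_of_nested hik hkl h2)
      (hb.comm_of_nested hik hkl h2) hik.ne hil hjk hjl hxij hxkl

/-- Below the first letter the induction hypothesis applies, and `liftVia_eq_liftVia` shows that the
choice of the first letter does not matter. -/
theorem liftUniqueBelow (hb : IsBandFamily b) (m : ℕ) : LiftUniqueBelow b m := by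
  induction m with
  | zero => intro y g g' _ h; exact absurd h (Nat.not_lt_zero _)
  | succ m ih =>
    intro x g g' hx hm hg hg'
    rcases Nat.lt_succ_iff_lt_or_eq.mp hm with h | h
    · exact ih x g g' hx h hg hg'
    rw [← h] at ih
    have first : ∀ {i j}, i < j → Prefix absLen (swap i j) x → ∀ {g₀}, IsLift b (swap i j * x) g₀ →
        b i j * g₀ = liftVia b x i j := by
      intro i j hij hp g₀ hg₀
      have h1 : IsNC (swap i j * x) := by
        have h2 := hp.right conjLength_absLen
        rw [swap_inv] at h2
        exact hx.of_prefix h2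
      rw [liftVia, ih _ _ _ h1 (by have := absLen_swap_mul hij hp; omega) hg₀ (isLift_lift b _)]
    have ne_one : ∀ {i j}, i < j → Prefix absLen (swap i j) x → x ≠ 1 := by
      rintro i j hij hp rfl
      exact hij.ne (swap_eq_one_iff.mp (hp.eq_one conjLength_absLen))
    rcases hg.exists_eq with ⟨h1, h2⟩ | ⟨i, j, g₀, hij, hp, hl, rfl⟩
    · rcases hg'.exists_eq with ⟨h3, h4⟩ | ⟨i, j, g₀, hij, hp, hl, rfl⟩
      · rw [h2, h4]
      · exact absurd h1 (ne_one hij hp)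
    · rcases hg'.exists_eq with ⟨h3, h4⟩ | ⟨k, l, g₁, hkl, hp', hl', rfl⟩
      · exact absurd h3 (ne_one hij hp)
      · rw [first hij hp hl, first hkl hp' hl']
        exact liftVia_eq_liftVia hb ih hx hij hkl ((hx.swap_prefix_iff hij).mp hp)
          ((hx.swap_prefix_iff hkl).mp hp')

theorem IsLift.eq_lift (hb : IsBandFamily b) (hx : IsNC x) (hg : IsLift b x g) : g = lift b x :=
  liftUniqueBelow hb (absLen x + 1) x g _ hx (Nat.lt_succ_self _) hg (isLift_lift b x)

theorem lift_one (hb : IsBandFamily b) : lift b (1 : Perm α) = 1 :=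
  (IsLift.one.eq_lift hb (fun _ _ h1 h2 => absurd (h1.trans h2) (lt_irrefl _))).symm

/-- Reduced products of lifts are lifts. -/
theorem IsLift.mul_isLift (hx : IsLift b x g) (hy : IsLift b y g')
    (h : Prefix absLen x (x * y)) : IsLift b (x * y) (g * g') := by
  induction hx with
  | one => simpa using hy
  | mul hij h1 hx ih =>
    rename_i i j x g
    rw [mul_assoc] at h ⊢
    rw [mul_assoc]
    have h2 := h1.trans conjLength_absLen h
    have h3 := (Prefix.mem_iff conjLength_absLen h2).mpr ⟨h1, h⟩
    rw [inv_mul_cancel_left] at h3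
    exact .mul hij h2 (ih h3)

theorem lift_mul (hb : IsBandFamily b) (hxy : IsNC (x * y)) (h : Prefix absLen x (x * y)) :
    lift b (x * y) = lift b x * lift b y :=
  (((isLift_lift b x).mul_isLift (isLift_lift b y) h).eq_lift hb hxy).symm

end Lift

/-! ### Left-weightedness under complement and conjugation -/

namespace GarsideInterval

variable {P : Type*} [Group P] {E : GarsideInterval P} {a b : P}

theorem weighted_iff (ha : E.le a E.top) (hb : E.le b E.top) :
    E.Weighted a b ↔ ∀ z, E.le z (E.compl a) → E.le z b → z = 1 := by
  constructor
  · intro h z hz hzb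
    have h1 : E.le z (E.moved a b) := le_inf_of (compl_le ha) hb hz hzb
    rw [Weighted] at h
    rw [h] at h1
    exact eq_one h1
  · intro h
    exact h _ (moved_le_compl ha hb) (moved_le ha hb)

theorem twist_compl (u : ℤ) (a : P) : E.compl (E.twist u a) = E.twist u (E.compl a) := by
  simp only [twist, compl]; group

theorem compl_compl (a : P) : E.compl (E.compl a) = E.twist 1 a := by
  simp only [twist, compl]; group

theorem twist_neg_twist (u : ℤ) (a : P) : E.twist (-u) (E.twist u a) = a := by
  simp only [twist]; group

theorem twist_le_twist (u : ℤ) {x y : P} (h : E.le x y) : E.le (E.twist u x) (E.twist u y) :=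
  conj_le _ h

theorem le_twist_iff (u : ℤ) {x y : P} : E.le (E.twist (-u) x) y ↔ E.le x (E.twist u y) := by
  constructor
  · intro h
    have h1 := twist_le_twist u h
    rwa [← twist_add, add_neg_cancel, show E.twist 0 x = x by simp [twist]] at h1
  · intro h
    have h1 := twist_le_twist (-u) h
    rwa [twist_neg_twist] at h1

theorem twist_eq_one_iff (u : ℤ) (x : P) : E.twist u x = 1 ↔ x = 1 := by
  constructor
  · intro h
    have h1 := twist_neg_twist (E := E) u x
    rw [h] at h1
    rw [← h1]; simp [twist]
  · rintro rfl; simp [twist]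

theorem forall_twist (u : ℤ) (x y : P) :
    (∀ z, E.le z (E.twist u x) → E.le z (E.twist u y) → z = 1) ↔
      ∀ z, E.le z x → E.le z y → z = 1 := by
  constructor
  · intro h z h1 h2
    exact (twist_eq_one_iff u z).mp (h _ (twist_le_twist u h1) (twist_le_twist u h2))
  · intro h z h1 h2
    exact (twist_eq_one_iff (-u) z).mp (h _ ((le_twist_iff u).mpr h1) ((le_twist_iff u).mpr h2))

theorem weighted_twist (u : ℤ) (ha : E.le a E.top) (hb : E.le b E.top) :
    E.Weighted (E.twist u a) (E.twist u b) ↔ E.Weighted a b := by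
  rw [weighted_iff (twist_le u ha) (twist_le u hb), weighted_iff ha hb, twist_compl, forall_twist]

/-- The condition of `weighted_iff` is symmetric in the complement of `a` and `b`. Since the double
complement of `b` is `twist 1 b`, the left side is that condition twisted, with the two elements
exchanged. -/
theorem weighted_compl (ha : E.le a E.top) (hb : E.le b E.top) :
    E.Weighted (E.compl b) (E.twist 1 (E.compl a)) ↔ E.Weighted a b := by
  rw [weighted_iff (compl_le hb) (twist_le 1 (compl_le ha)), weighted_iff ha hb, compl_compl,
    forall_twist]
  exact ⟨fun h z h1 h2 => h z h2 h1, fun h z h1 h2 => h z h2 h1⟩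

end GarsideInterval

/-! ### Homomorphisms from the braid group: permutations and streams -/

/-- The positions of the strands. -/
abbrev Strand (n : ℕ) : Type := {i : ℕ // i ∈ Finset.Icc 1 n}

section Strands

variable {n : ℕ}

theorem Strand.bounds (i : Strand n) : 1 ≤ (i : ℕ) ∧ (i : ℕ) ≤ n := Finset.mem_Icc.mp i.2

/-- The band generators, indexed by pairs of strands. -/
def strandBand (n : ℕ) (i j : Strand n) : BraidGroup n := band n j i

theorem isBandFamily_strandBand : IsBandFamily (strandBand n) where
  triple h1 h2 := band_mul_band h1 h2
  triple' {r _ t} h1 h2 := band_mul_band' r.bounds.1 h1 h2 t.bounds.2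
  comm_of_lt h1 h2 h3 := (band_commute_of_lt h1 h2 h3).symm
  comm_of_nested {i j _ _} h1 h2 h3 := band_commute_of_nested i.bounds.1 h1 h2 h3 j.bounds.2

theorem strandBand_mem (i j : Strand n) (h : i < j) : strandBand n i j ∈ bandGenerators n :=
  ⟨j, i, i.bounds.1, h, j.bounds.2, rfl⟩

theorem exists_strandBand {a : BraidGroup n} (ha : a ∈ bandGenerators n) :
    ∃ i j : Strand n, i < j ∧ a = strandBand n i j := by
  obtain ⟨t, s, h1, h2, h3, rfl⟩ := ha
  exact ⟨⟨s, Finset.mem_Icc.mpr ⟨h1, by omega⟩⟩, ⟨t, Finset.mem_Icc.mpr ⟨by omega, h3⟩⟩, h2, rfl⟩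

/-- The lower one of the two strands which the Artin generator `i` exchanges. -/
def ArtinIndex.low (i : ArtinIndex n) : Strand n :=
  ⟨i, Finset.mem_Icc.mpr ⟨i.2.1, i.2.2.le⟩⟩

/-- The upper one of the two strands which the Artin generator `i` exchanges. -/
def ArtinIndex.high (i : ArtinIndex n) : Strand n :=
  ⟨i + 1, Finset.mem_Icc.mpr ⟨by omega, i.2.2⟩⟩

theorem ArtinIndex.low_lt_high (i : ArtinIndex n) : i.low < i.high :=
  Nat.lt_succ_self (i : ℕ)

/-- The homomorphism from the braid group given by a family which satisfies the relations between
the band generators. -/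
def bandHom {H : Type*} [Group H] {g : Strand n → Strand n → H} (hg : IsBandFamily g) :
    BraidGroup n →* H :=
  PresentedGroup.toGroup (f := fun i : ArtinIndex n => g i.low i.high) (by
    rintro r (⟨i, j, h, rfl⟩ | ⟨i, j, h, rfl⟩)
    · simp only [map_mul, map_inv, FreeGroup.lift_apply_of, mul_inv_eq_one]
      exact hg.comm_of_lt i.low_lt_high h j.low_lt_high
    · simp only [map_mul, map_inv, FreeGroup.lift_apply_of, mul_inv_eq_one]
      have e : i.high = j.low := Subtype.ext h
      have h1 := i.low_lt_high
      have h2 := j.low_lt_high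
      rw [← e] at h2 ⊢
      have h3 := hg.triple h1 h2
      have h4 := hg.triple' h1 h2
      calc g i.low i.high * g i.high j.high * g i.low i.high
          = g i.low i.high * g i.low j.high * g i.high j.high := by rw [mul_assoc, h3, mul_assoc]
        _ = _ := by rw [h4])

/-- The triple relation expresses each band through bands with a closer upper strand and an Artin
generator, so the values on the `sigma` determine all others. -/
theorem bandHom_strandBand {H : Type*} [Group H] {g : Strand n → Strand n → H}
    (hg : IsBandFamily g) {i j : Strand n} (h : i < j) : bandHom hg (strandBand n i j) = g i j := by
  have hsigma : ∀ {i j : Strand n}, (j : ℕ) = i + 1 → bandHom hg (sigma n i) = g i j := by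
    intro i j hij
    have hi : 1 ≤ (i : ℕ) ∧ (i : ℕ) < n := ⟨i.bounds.1, by have := j.bounds.2; omega⟩
    rw [sigma, dif_pos hi, bandHom, PresentedGroup.toGroup.of]
    congr 1
    exact Subtype.ext hij.symm
  obtain ⟨j, hj⟩ := j
  induction j with
  | zero => exact absurd h (Nat.not_lt_zero _)
  | succ j ih =>
    rcases (Nat.lt_succ_iff.mp (show (i : ℕ) < j + 1 from h)).eq_or_lt with h1 | h1
    · subst h1
      rw [strandBand, band_succ]
      exact hsigma (j := ⟨i + 1, hj⟩) rfl
    · have hj' : j ∈ Finset.Icc 1 n := by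
        rw [Finset.mem_Icc] at hj ⊢; have := i.bounds; omega
      have h2 := congrArg (bandHom hg) (isBandFamily_strandBand.triple
        (r := i) (s := ⟨j, hj'⟩) (t := ⟨j + 1, hj⟩) h1 (Nat.lt_succ_self j))
      have h3 := hg.triple (r := i) (s := ⟨j, hj'⟩) (t := ⟨j + 1, hj⟩) h1 (Nat.lt_succ_self j)
      have h4 : bandHom hg (strandBand n ⟨j, hj'⟩ ⟨j + 1, hj⟩) = g ⟨j, hj'⟩ ⟨j + 1, hj⟩ := by
        rw [strandBand, band_succ]
        exact hsigma (i := ⟨j, hj'⟩) (j := ⟨j + 1, hj⟩) rfl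
      rw [map_mul, map_mul, h4, ih hj' h1, h3] at h2
      exact (mul_right_cancel h2).symm

theorem isBandFamily_swap : IsBandFamily (fun i j : Strand n => swap i j) where
  triple h1 h2 := swap_mul_swap h1 h2
  triple' h1 h2 := swap_mul_swap' h1 h2
  comm_of_lt h1 h2 h3 := swap_commute (h1.trans h2).ne (h1.trans (h2.trans h3)).ne h2.ne
    (h2.trans h3).ne
  comm_of_nested h1 h2 h3 := swap_commute h1.ne (h1.trans h2).ne (h2.trans h3).ne' h3.ne'

/-- The permutation of the strands induced by a braid. -/
def toPerm (n : ℕ) : BraidGroup n →* Perm (Strand n) := bandHom isBandFamily_swap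

theorem toPerm_strandBand {i j : Strand n} (h : i < j) : toPerm n (strandBand n i j) = swap i j :=
  bandHom_strandBand isBandFamily_swap h

theorem toPerm_descProd {t s : ℕ} (h1 : 1 ≤ s) (h2 : s ≤ t) (h3 : t ≤ n) (k : Strand n) :
    (toPerm n (descProd n t s) k : ℕ) =
      if (k : ℕ) < s ∨ t < k then (k : ℕ) else if (k : ℕ) = s then t else k - 1 := by
  induction t, h2 using Nat.le_induction with
  | base => rw [descProd_self, map_one, Perm.one_apply]; split_ifs <;> omega
  | succ t ht ih =>
    have ih := ih (by omega)
    have e : toPerm n (sigma n t) = swap (⟨t, Finset.mem_Icc.mpr ⟨by omega, by omega⟩⟩ : Strand n)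
        ⟨t + 1, Finset.mem_Icc.mpr ⟨by omega, h3⟩⟩ := by
      rw [← toPerm_strandBand (Nat.lt_succ_self t), strandBand, band_succ]
    rw [descProd_succ ht, map_mul, Perm.mul_apply, e, swap_apply_def]
    simp only [Subtype.ext_iff]
    split_ifs at ih ⊢ <;> simp_all <;> omega

/-- The permutation induced by `δ`. -/
def deltaPerm (n : ℕ) : Perm (Strand n) := toPerm n (delta n)

theorem deltaPerm_apply (k : Strand n) :
    (deltaPerm n k : ℕ) = if (k : ℕ) = 1 then n else k - 1 := by
  have hk := k.bounds
  rw [deltaPerm, delta, toPerm_descProd le_rfl (by omega) le_rfl]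
  split_ifs <;> omega

theorem isNC_deltaPerm : IsNC (deltaPerm n) := by
  intro i k h1 h2
  have hi := deltaPerm_apply i
  have h1' : (deltaPerm n i : ℕ) < k := h1
  have h2' : (k : ℕ) < i := h2
  have := k.bounds
  have := i.bounds
  split_ifs at hi <;> omega

theorem sameCycle_deltaPerm (i j : Strand n) : (deltaPerm n).SameCycle i j := by
  have key : ∀ (m : ℕ) (hm : m + 1 ∈ Finset.Icc 1 n) (h1 : 1 ∈ Finset.Icc 1 n),
      (deltaPerm n).SameCycle ⟨m + 1, hm⟩ ⟨1, h1⟩ := by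
    intro m
    induction m with
    | zero => intro hm h1; exact SameCycle.refl _ _
    | succ m ih =>
      intro hm h1
      have hm' : m + 1 ∈ Finset.Icc 1 n := by rw [Finset.mem_Icc] at hm ⊢; omega
      have h2 : deltaPerm n ⟨m + 1 + 1, hm⟩ = ⟨m + 1, hm'⟩ := by
        apply Subtype.ext
        rw [deltaPerm_apply]
        simp
      rw [← sameCycle_apply_left, h2]
      exact ih hm' h1
  have h1 : 1 ∈ Finset.Icc 1 n := by rw [Finset.mem_Icc]; have := i.bounds; omega
  have key' : ∀ i : Strand n, (deltaPerm n).SameCycle i ⟨1, h1⟩ := by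
    rintro ⟨i, hi⟩
    obtain ⟨m, rfl⟩ : ∃ m, i = m + 1 := ⟨i - 1, by rw [Finset.mem_Icc] at hi; omega⟩
    exact key m hi h1
  exact (key' i).trans (key' j).symm

/-- `deltaPerm n` has a single cycle, so the refinement condition is void. -/
theorem prefix_deltaPerm_iff {x : Perm (Strand n)} : Prefix absLen x (deltaPerm n) ↔ IsNC x :=
  ⟨isNC_deltaPerm.of_prefix,
    fun h => h.prefix_of_sameCycle isNC_deltaPerm fun _ => sameCycle_deltaPerm _ _⟩

theorem le_absLen_deltaPerm (hn : 1 ≤ n) : n ≤ absLen (deltaPerm n) + 1 := by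
  -- The invariant functions of a single cycle are the constants.
  have h1 : fixedFun (deltaPerm n) ≤ Submodule.span ℚ {fun _ => (1 : ℚ)} := by
    intro f hf
    rw [Submodule.mem_span_singleton]
    have h1 : 1 ∈ Finset.Icc 1 n := by rw [Finset.mem_Icc]; omega
    refine ⟨f ⟨1, h1⟩, funext fun k => ?_⟩
    have h2 := (SameCycle.iff_of_invariant (sameCycle_deltaPerm ⟨1, h1⟩ k)
      (fun m => f m = f ⟨1, h1⟩) (fun m hm => (hf m).trans hm)).mp rfl
    simp [h2]
  have h2 := Submodule.finrank_mono h1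
  have h3 := finrank_span_le_card (R := ℚ) ({fun _ => (1 : ℚ)} : Set (Strand n → ℚ))
  have h4 := absLen_add_finrank (deltaPerm n)
  simp at h3 h4
  omega

/-- The interval of noncrossing permutations of the strands. -/
noncomputable def strandInterval (n : ℕ) : GarsideInterval (Perm (Strand n)) :=
  ncInterval (deltaPerm n) isNC_deltaPerm

theorem strandInterval_le_top {x : Perm (Strand n)} :
    (strandInterval n).le x (strandInterval n).top ↔ IsNC x :=
  prefix_deltaPerm_iff

theorem perm_swap_mul_perm_swap {i j k l : Strand n} (hij : i < j)
    (h : IsNC (swap i j * swap k l)) (hc : (swap i j * swap k l).SameCycle i j) :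
    (strandInterval n).perm (swap i j) * (strandInterval n).perm (swap k l) =
      (strandInterval n).perm (swap i j * swap k l) :=
  GarsideInterval.perm_mul ((h.swap_prefix_iff hij).mpr hc) (strandInterval_le_top.mpr h)

theorem commute_perm_swap {i j k l : Strand n} (hij : i < j) (hkl : k < l)
    (h : IsNC (swap i j * swap k l)) (h1 : i ≠ k) (h2 : i ≠ l) (h3 : j ≠ k) (h4 : j ≠ l) :
    Commute ((strandInterval n).perm (swap i j)) ((strandInterval n).perm (swap k l)) := by
  have e := swap_commute h1 h2 h3 h4
  rw [Commute, SemiconjBy, perm_swap_mul_perm_swap hij h (sameCycle_swap_mul_swap h1 h2),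
    perm_swap_mul_perm_swap hkl (e ▸ h) (sameCycle_swap_mul_swap h1.symm h3.symm)]
  exact congrArg _ e

theorem isBandFamily_perm :
    IsBandFamily (fun i j : Strand n => (strandInterval n).perm (swap i j)) where
  triple h1 h2 := by
    have hc := sameCycle_triple h1 h2
    have e := swap_mul_swap h1 h2
    rw [perm_swap_mul_perm_swap h2 (isNC_triple h1 h2) hc.1,
      perm_swap_mul_perm_swap (h1.trans h2) (e ▸ isNC_triple h1 h2) (e ▸ hc.2.trans hc.1)]
    exact congrArg _ e
  triple' h1 h2 := by
    have hc := sameCycle_triple h1 h2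
    have e := swap_mul_swap' h1 h2
    rw [perm_swap_mul_perm_swap h2 (isNC_triple h1 h2) hc.1,
      perm_swap_mul_perm_swap h1 (e ▸ isNC_triple h1 h2) (e ▸ hc.2)]
    exact congrArg _ e
  comm_of_lt h1 h2 h3 := commute_perm_swap h1 h3 (isNC_swap_mul_swap_of_lt h1 h2 h3)
    (h1.trans h2).ne (h1.trans (h2.trans h3)).ne h2.ne (h2.trans h3).ne
  comm_of_nested h1 h2 h3 := commute_perm_swap (h1.trans (h2.trans h3)) h2
    (isNC_swap_mul_swap_of_nested h1 h2 h3) h1.ne (h1.trans h2).ne (h2.trans h3).ne' h3.ne'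

/-- The action of the braid group on streams of noncrossing permutations. -/
noncomputable def streamHom (n : ℕ) : BraidGroup n →* Perm (strandInterval n).StreamQuot :=
  bandHom isBandFamily_perm

/-- The simple braid with a given noncrossing permutation. -/
noncomputable def simpleBraid (x : Perm (Strand n)) : BraidGroup n := lift (strandBand n) x

theorem streamHom_of_isLift {x : Perm (Strand n)} {g : BraidGroup n}
    (h : IsLift (strandBand n) x g) (hx : IsNC x) : streamHom n g = (strandInterval n).perm x := by
  induction h with
  | one => rw [map_one, GarsideInterval.perm_one]
  | mul hij h1 h2 ih =>
    have h3 := h1.right conjLength_absLen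
    rw [inv_mul_cancel_left] at h3
    rw [map_mul, ih (hx.of_prefix h3), streamHom, bandHom_strandBand isBandFamily_perm hij]
    exact GarsideInterval.perm_mul h1 (strandInterval_le_top.mpr hx)

theorem toPerm_of_isLift {x : Perm (Strand n)} {g : BraidGroup n}
    (h : IsLift (strandBand n) x g) : toPerm n g = x := by
  induction h with
  | one => rw [map_one]
  | mul hij h1 h2 ih =>
    rw [map_mul, ih, toPerm_strandBand hij]
    rfl

theorem mem_positiveBraids_of_isLift {x : Perm (Strand n)} {g : BraidGroup n}
    (h : IsLift (strandBand n) x g) : g ∈ positiveBraids n := by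
  induction h with
  | one => exact one_mem _
  | mul hij h1 h2 ih =>
    exact mul_mem (Submonoid.subset_closure (strandBand_mem _ _ hij)) ih

theorem toPerm_simpleBraid (x : Perm (Strand n)) : toPerm n (simpleBraid x) = x :=
  toPerm_of_isLift (isLift_lift _ x)

theorem simpleBraid_mem (x : Perm (Strand n)) : simpleBraid x ∈ positiveBraids n :=
  mem_positiveBraids_of_isLift (isLift_lift _ x)

theorem streamHom_simpleBraid {x : Perm (Strand n)} (hx : IsNC x) :
    streamHom n (simpleBraid x) = (strandInterval n).perm x :=
  streamHom_of_isLift (isLift_lift _ x) hx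

theorem simpleBraid_mul {x y : Perm (Strand n)} (hxy : IsNC (x * y))
    (h : Prefix absLen x (x * y)) : simpleBraid (x * y) = simpleBraid x * simpleBraid y :=
  lift_mul isBandFamily_strandBand hxy h

end Strands

variable {n : ℕ}

/-! ### Word length of positive braids against absolute length -/

section Positive

theorem exists_word {g : BraidGroup n} (hg : g ∈ positiveBraids n) :
    ∃ l : List (BraidGroup n), (∀ a ∈ l, a ∈ bandGenerators n) ∧ l.prod = g ∧
      l.length = wordLength g := by
  obtain ⟨l, hl, h⟩ := Submonoid.exists_list_of_mem_closure hg
  exact ⟨l, hl, h, (wordLength_eq l hl h).symm⟩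

theorem wordLength_mul {g h : BraidGroup n} (hg : g ∈ positiveBraids n)
    (hh : h ∈ positiveBraids n) : wordLength (g * h) = wordLength g + wordLength h := by
  obtain ⟨l, h1, h2, h3⟩ := exists_word hg
  obtain ⟨l', h4, h5, h6⟩ := exists_word hh
  rw [wordLength_eq (l ++ l') (fun a ha => (List.mem_append.mp ha).elim (h1 a) (h4 a))
    (by rw [List.prod_append, h2, h5]), List.length_append, h3, h6]

theorem absLen_toPerm_prod_le (l : List (BraidGroup n)) (hl : ∀ a ∈ l, a ∈ bandGenerators n) :
    absLen (toPerm n l.prod) ≤ l.length := by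
  induction l with
  | nil => simp [conjLength_absLen.one]
  | cons a l ih =>
    obtain ⟨i, j, hij, rfl⟩ := exists_strandBand (hl a (by simp))
    have h1 := conjLength_absLen.mul_le (swap i j) (toPerm n l.prod)
    have h2 := absLen_swap_le i j
    have h3 := ih fun b hb => hl b (by simp [hb])
    rw [List.prod_cons, map_mul, toPerm_strandBand hij, List.length_cons]
    omega

theorem absLen_toPerm_le {g : BraidGroup n} (hg : g ∈ positiveBraids n) :
    absLen (toPerm n g) ≤ wordLength g := by
  obtain ⟨l, h1, rfl, h3⟩ := exists_word hg
  rw [← h3]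
  exact absLen_toPerm_prod_le l h1

/-- A positive word with no more letters than the absolute length of its permutation is a reduced
factorization, and so is each of its tails. -/
theorem isLift_of_absLen_eq {g : BraidGroup n} (hg : g ∈ positiveBraids n)
    (h : absLen (toPerm n g) = wordLength g) : IsLift (strandBand n) (toPerm n g) g := by
  obtain ⟨l, h1, rfl, h3⟩ := exists_word hg
  rw [← h3] at h
  clear h3 hg
  induction l with
  | nil => simpa using IsLift.one
  | cons a l ih =>
    obtain ⟨i, j, hij, rfl⟩ := exists_strandBand (h1 a (by simp))
    have hl : ∀ b ∈ l, b ∈ bandGenerators n := fun b hb => h1 b (by simp [hb])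
    rw [List.prod_cons, map_mul, toPerm_strandBand hij] at h ⊢
    rw [List.length_cons] at h
    have h4 := conjLength_absLen.mul_le (swap i j) (toPerm n l.prod)
    have h5 := absLen_swap_le i j
    have h6 := absLen_toPerm_prod_le l hl
    refine .mul hij (Prefix.mul_iff.mpr ?_) (ih hl (by omega))
    change absLen (swap i j) + _ = absLen (swap i j * _)
    omega

theorem sigma_mem {i : ℕ} (h1 : 1 ≤ i) (h2 : i < n) : sigma n i ∈ bandGenerators n :=
  ⟨i + 1, i, h1, by omega, h2, (band_succ i).symm⟩

theorem exists_word_delta : ∃ l : List (BraidGroup n), (∀ a ∈ l, a ∈ bandGenerators n) ∧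
    l.prod = delta n ∧ l.length = n - 1 := by
  refine ⟨(List.Ico 1 n).reverse.map (sigma n), ?_, rfl, by simp⟩
  intro a ha
  simp only [List.mem_map, List.mem_reverse, List.Ico.mem] at ha
  obtain ⟨i, ⟨h1, h2⟩, rfl⟩ := ha
  exact sigma_mem h1 h2

theorem delta_mem : delta n ∈ positiveBraids n := by
  obtain ⟨l, h1, h2, -⟩ := exists_word_delta (n := n)
  rw [← h2]
  exact Submonoid.list_prod_mem _ fun a ha => Submonoid.subset_closure (h1 a ha)

theorem wordLength_delta : wordLength (delta n) = n - 1 := by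
  obtain ⟨l, h1, h2, h3⟩ := exists_word_delta (n := n)
  rw [wordLength_eq l h1 h2, h3]

theorem absLen_deltaPerm (hn : 1 ≤ n) : absLen (deltaPerm n) = wordLength (delta n) := by
  have h1 := le_absLen_deltaPerm hn
  have h2 := absLen_toPerm_le (delta_mem (n := n))
  rw [wordLength_delta] at h2 ⊢
  rw [deltaPerm] at h1 ⊢
  omega

theorem simpleBraid_deltaPerm (hn : 1 ≤ n) : simpleBraid (deltaPerm n) = delta n :=
  ((isLift_of_absLen_eq delta_mem (absLen_deltaPerm hn)).eq_lift isBandFamily_strandBand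
    isNC_deltaPerm).symm

end Positive

/-! ### Canonical factors as noncrossing permutations -/

section CanonicalFactor

theorem IsCanonicalFactor.mem {A : BraidGroup n} (hA : IsCanonicalFactor A) :
    A ∈ positiveBraids n := by
  obtain ⟨⟨P, hP, Q, hQ, h⟩, -⟩ := hA
  rw [h]
  exact mul_mem (mul_mem hP (one_mem _)) hQ

/-- For `δ = P * A * Q` the word length equals the absolute length. Hence all the inequalities
between the two for `P`, `A`, `Q` are equalities, and the permutation of `A` is a factor in a
reduced product for `deltaPerm n`. -/
theorem IsCanonicalFactor.isNC_and_eq (hn : 1 ≤ n) {A : BraidGroup n} (hA : IsCanonicalFactor A) :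
    IsNC (toPerm n A) ∧ absLen (toPerm n A) = wordLength A ∧ simpleBraid (toPerm n A) = A := by
  have hAm := hA.mem
  obtain ⟨-, P, hP, Q, hQ, h⟩ := hA
  have h1 := absLen_deltaPerm hn
  have h2 := congrArg (toPerm n) h
  rw [map_mul, map_mul] at h2
  change deltaPerm n = _ at h2
  rw [h, wordLength_mul (mul_mem hP hAm) hQ, wordLength_mul hP hAm] at h1
  have h3 := absLen_toPerm_le hP
  have h4 := absLen_toPerm_le hAm
  have h5 := absLen_toPerm_le hQ
  have h6 := conjLength_absLen.mul_le (toPerm n P * toPerm n A) (toPerm n Q)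
  have h7 := conjLength_absLen.mul_le (toPerm n P) (toPerm n A)
  rw [← h2] at h6
  have h8 : absLen (toPerm n A) = wordLength A := by omega
  have h9 : Prefix absLen (toPerm n P * toPerm n A) (deltaPerm n) := by
    rw [h2, Prefix.mul_iff, ← h2]; omega
  have h10 : Prefix absLen (toPerm n P) (toPerm n P * toPerm n A) := by
    rw [Prefix.mul_iff]; omega
  have h11 := h10.right conjLength_absLen
  rw [inv_mul_cancel_left] at h11
  have h12 : IsNC (toPerm n A) :=
    isNC_deltaPerm.of_prefix (h11.trans conjLength_absLen h9)
  exact ⟨h12, h8,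
    ((isLift_of_absLen_eq hAm h8).eq_lift isBandFamily_strandBand h12).symm⟩

theorem simpleBraid_mul_compl (hn : 1 ≤ n) {x : Perm (Strand n)} (hx : IsNC x) :
    simpleBraid x * simpleBraid ((strandInterval n).compl x) = delta n := by
  have e : x * (strandInterval n).compl x = deltaPerm n := by
    simp [GarsideInterval.compl, strandInterval, ncInterval]
  rw [← simpleBraid_mul, e, simpleBraid_deltaPerm hn]
  · rw [e]; exact isNC_deltaPerm
  · rw [e]; exact prefix_deltaPerm_iff.mpr hx

theorem isCanonicalFactor_simpleBraid (hn : 1 ≤ n) {x : Perm (Strand n)} (hx : IsNC x) :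
    IsCanonicalFactor (simpleBraid x) :=
  ⟨⟨1, one_mem _, _, simpleBraid_mem x, by simp⟩,
    ⟨1, one_mem _, _, simpleBraid_mem _, by rw [one_mul, simpleBraid_mul_compl hn hx]⟩⟩

theorem wordLength_simpleBraid (hn : 1 ≤ n) {x : Perm (Strand n)} (hx : IsNC x) :
    wordLength (simpleBraid x) = absLen x := by
  have h := ((isCanonicalFactor_simpleBraid hn hx).isNC_and_eq hn).2.1
  rw [toPerm_simpleBraid] at h
  exact h.symm

theorem rightComplement_simpleBraid (hn : 1 ≤ n) {x : Perm (Strand n)} (hx : IsNC x) :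
    rightComplement (simpleBraid x) = simpleBraid ((strandInterval n).compl x) := by
  rw [rightComplement, ← simpleBraid_mul_compl hn hx, inv_mul_cancel_left]

theorem isNC_compl {x : Perm (Strand n)} (hx : IsNC x) : IsNC ((strandInterval n).compl x) :=
  strandInterval_le_top.mp (GarsideInterval.compl_le (strandInterval_le_top.mpr hx))

theorem isNC_twist (u : ℤ) {x : Perm (Strand n)} (hx : IsNC x) :
    IsNC ((strandInterval n).twist u x) :=
  strandInterval_le_top.mp (GarsideInterval.twist_le u (strandInterval_le_top.mpr hx))

theorem tau_simpleBraid (hn : 1 ≤ n) {x : Perm (Strand n)} (hx : IsNC x) :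
    tau n (simpleBraid x) = simpleBraid ((strandInterval n).twist 1 x) := by
  rw [← GarsideInterval.compl_compl, ← rightComplement_simpleBraid hn (isNC_compl hx),
    ← rightComplement_simpleBraid hn hx]
  simp [tau, rightComplement]

theorem tau_zpow_simpleBraid (hn : 1 ≤ n) (u : ℤ) {x : Perm (Strand n)} (hx : IsNC x) :
    (tau n ^ u) (simpleBraid x) = simpleBraid ((strandInterval n).twist u x) := by
  induction u using Int.induction_on with
  | zero => simp [GarsideInterval.twist]
  | succ m ih =>
    rw [add_comm (m : ℤ) 1, zpow_one_add, MulAut.mul_apply, ih,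
      tau_simpleBraid hn (isNC_twist _ hx), GarsideInterval.twist_add]
  | pred m ih =>
    apply (tau n).injective
    rw [← MulAut.mul_apply, ← zpow_one_add, add_sub_cancel, ih,
      tau_simpleBraid hn (isNC_twist _ hx), ← GarsideInterval.twist_add, add_sub_cancel]

theorem tau_zpow_apply (u : ℤ) (A : BraidGroup n) :
    (tau n ^ u) A = (delta n ^ u)⁻¹ * A * delta n ^ u := by
  rw [tau, ← map_zpow, MulAut.conj_apply, inv_zpow, inv_inv]

/-- Positive braids never need an inverse of the top element: they preserve the classes of honest
streams. -/
theorem streamHom_mk_zero {g : BraidGroup n} (hg : g ∈ positiveBraids n)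
    (A : (strandInterval n).NormalStream) :
    ∃ B, streamHom n g (GarsideInterval.cls 0 A) = GarsideInterval.cls 0 B := by
  induction hg using Submonoid.closure_induction generalizing A with
  | mem a ha =>
    obtain ⟨i, j, hij, rfl⟩ := exists_strandBand ha
    rw [streamHom, bandHom_strandBand isBandFamily_perm hij]
    exact ⟨_, GarsideInterval.perm_cls_zero (strandInterval_le_top.mpr (isNC_swap hij)) A⟩
  | one => exact ⟨A, by simp⟩
  | mul g h _ _ ihg ihh =>
    obtain ⟨B, hB⟩ := ihh A
    obtain ⟨C, hC⟩ := ihg B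
    exact ⟨C, by rw [map_mul, Perm.mul_apply, hB, hC]⟩

/-- Left-weightedness of two simple braids is left-weightedness of their permutations. -/
theorem leftWeighted_simpleBraid (hn : 1 ≤ n) {a b : Perm (Strand n)} (ha : IsNC a) (hb : IsNC b) :
    LeftWeighted (simpleBraid a) (simpleBraid b) ↔ (strandInterval n).Weighted a b := by
  have ha' := strandInterval_le_top.mpr ha
  have hb' := strandInterval_le_top.mpr hb
  constructor
  · rintro ⟨-, -, h⟩
    obtain ⟨h1, h2⟩ := GarsideInterval.le_mul_moved ha' hb'
    have h3 := GarsideInterval.moved_le ha' hb'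
    have h4 : IsNC (a * (strandInterval n).moved a b) := strandInterval_le_top.mp h2
    have h5 : simpleBraid b = simpleBraid ((strandInterval n).moved a b) *
        simpleBraid (((strandInterval n).moved a b)⁻¹ * b) := by
      rw [← simpleBraid_mul, mul_inv_cancel_left]
      · rwa [mul_inv_cancel_left]
      · rw [mul_inv_cancel_left]; exact h3
    -- Moving the common prefix from `b` to `a` gives a competing decomposition, so maximality
    -- forces this prefix to have length zero.
    have h6 := h (simpleBraid (a * (strandInterval n).moved a b))
      (simpleBraid (((strandInterval n).moved a b)⁻¹ * b)) (isCanonicalFactor_simpleBraid hn h4)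
      (simpleBraid_mem _) (by rw [simpleBraid_mul h4 h1, h5, mul_assoc])
    have h7 : absLen a + absLen ((strandInterval n).moved a b) =
        absLen (a * (strandInterval n).moved a b) := Prefix.mul_iff.mp h1
    rw [wordLength_simpleBraid hn h4, wordLength_simpleBraid hn ha] at h6
    exact conjLength_absLen.eq_one _ (by omega)
  · intro h
    refine ⟨isCanonicalFactor_simpleBraid hn ha, simpleBraid_mem b, ?_⟩
    intro A P hA hP hAP
    obtain ⟨h1, h2, h3⟩ := hA.isNC_and_eq hn
    rw [wordLength_simpleBraid hn ha, ← h2]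
    have hl : ∀ x ∈ [a, b], (strandInterval n).le x (strandInterval n).top := by
      simp [ha', hb']
    have hc : [a, b].IsChain (strandInterval n).Weighted := by simpa using h
    have h4 := GarsideInterval.prod_perm_ofChain [a, b] hl hc
    -- Both decompositions act on the base point. The one by `a`, `b` gives a stream with first
    -- entry `a`; the other gives a stream whose first entry has the permutation of `A` as a prefix.
    obtain ⟨C, hC⟩ := streamHom_mk_zero hP
      (GarsideInterval.ofChain (E := strandInterval n) [] (by simp) .nil)
    have h5 : streamHom n (A * P) = ([a, b].map (strandInterval n).perm).prod := by
      rw [hAP, map_mul, streamHom_simpleBraid ha, streamHom_simpleBraid hb]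
      simp
    rw [← h5, map_mul, Perm.mul_apply, hC, ← h3, streamHom_simpleBraid h1,
      GarsideInterval.perm_cls_zero (strandInterval_le_top.mpr h1)] at h4
    have h6 := congrArg Subtype.val (GarsideInterval.cls_injective 0 h4)
    have h7 : (strandInterval n).act (toPerm n A) C.1 0 = a := congrFun h6 0
    have h8 := GarsideInterval.le_act_zero (strandInterval_le_top.mpr h1) C.2
    rw [h7] at h8
    have h9 : absLen (toPerm n A) + absLen ((toPerm n A)⁻¹ * a) = absLen a := h8
    omega

end CanonicalFactor

/-! ### Left-canonical forms and their inverses -/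

section CanonicalForm

theorem leftWeighted_iff_rightComplement (hn : 1 ≤ n) {A B : BraidGroup n}
    (hA : IsCanonicalFactor A) (hB : IsCanonicalFactor B) :
    LeftWeighted A B ↔ LeftWeighted (rightComplement B) (tau n (rightComplement A)) := by
  obtain ⟨ha, -, ea⟩ := hA.isNC_and_eq hn
  obtain ⟨hb, -, eb⟩ := hB.isNC_and_eq hn
  rw [← ea, ← eb, rightComplement_simpleBraid hn ha, rightComplement_simpleBraid hn hb,
    tau_simpleBraid hn (isNC_compl ha), leftWeighted_simpleBraid hn ha hb,
    leftWeighted_simpleBraid hn (isNC_compl hb) (isNC_twist 1 (isNC_compl ha)),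
    GarsideInterval.weighted_compl (strandInterval_le_top.mpr ha) (strandInterval_le_top.mpr hb)]

theorem leftWeighted_tau_zpow (hn : 1 ≤ n) (u : ℤ) {A B : BraidGroup n}
    (hA : IsCanonicalFactor A) (hB : IsCanonicalFactor B) :
    LeftWeighted ((tau n ^ u) A) ((tau n ^ u) B) ↔ LeftWeighted A B := by
  obtain ⟨ha, -, ea⟩ := hA.isNC_and_eq hn
  obtain ⟨hb, -, eb⟩ := hB.isNC_and_eq hn
  rw [← ea, ← eb, tau_zpow_simpleBraid hn u ha, tau_zpow_simpleBraid hn u hb,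
    leftWeighted_simpleBraid hn ha hb,
    leftWeighted_simpleBraid hn (isNC_twist u ha) (isNC_twist u hb),
    GarsideInterval.weighted_twist u (strandInterval_le_top.mpr ha)
      (strandInterval_le_top.mpr hb)]

theorem IsCanonicalFactor.rightComplement (hn : 1 ≤ n) {A : BraidGroup n}
    (hA : IsCanonicalFactor A) : IsCanonicalFactor (rightComplement A) := by
  obtain ⟨ha, -, ea⟩ := hA.isNC_and_eq hn
  rw [← ea, rightComplement_simpleBraid hn ha]
  exact isCanonicalFactor_simpleBraid hn (isNC_compl ha)

theorem IsCanonicalFactor.tau_zpow (hn : 1 ≤ n) (u : ℤ) {A : BraidGroup n}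
    (hA : IsCanonicalFactor A) : IsCanonicalFactor ((tau n ^ u) A) := by
  obtain ⟨ha, -, ea⟩ := hA.isNC_and_eq hn
  rw [← ea, tau_zpow_simpleBraid hn u ha]
  exact isCanonicalFactor_simpleBraid hn (isNC_twist u ha)

theorem deltaPerm_ne_one (hn : 2 ≤ n) : deltaPerm n ≠ 1 := by
  intro h
  have h1 := le_absLen_deltaPerm (n := n) (by omega)
  rw [h, conjLength_absLen.one] at h1
  omega

/-- Both forms are translated into permutations, where the action of `W` on streams determines the
exponent and the list. -/
theorem IsLeftCanonicalForm.unique (hn : 2 ≤ n) {W : BraidGroup n} {u v : ℤ}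
    {As Bs : List (BraidGroup n)} (hA : IsLeftCanonicalForm W u As)
    (hB : IsLeftCanonicalForm W v Bs) : u = v ∧ As = Bs := by
  have hn1 : 1 ≤ n := by omega
  have key : ∀ {u As}, IsLeftCanonicalForm W u As →
      (As.map (toPerm n)).map simpleBraid = As ∧
      (∀ a ∈ As.map (toPerm n), (strandInterval n).le a (strandInterval n).top ∧ a ≠ 1 ∧
        a ≠ (strandInterval n).top) ∧
      (As.map (toPerm n)).IsChain (strandInterval n).Weighted ∧
      streamHom n W = (strandInterval n).perm (strandInterval n).top ^ u *
        ((As.map (toPerm n)).map (strandInterval n).perm).prod := by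
    rintro u As ⟨rfl, h1, h2⟩
    refine ⟨?_, ?_, ?_, ?_⟩
    · rw [List.map_map]
      conv_rhs => rw [← List.map_id As]
      exact List.map_congr_left fun A hA => ((h1 A hA).1.isNC_and_eq hn1).2.2
    · intro a ha
      obtain ⟨A, hA, rfl⟩ := List.mem_map.mp ha
      obtain ⟨h3, h4, h5⟩ := h1 A hA
      obtain ⟨h6, -, h7⟩ := h3.isNC_and_eq hn1
      refine ⟨strandInterval_le_top.mpr h6, fun h => h4 ?_, fun h => h5 ?_⟩
      · rw [← h7, h]; exact lift_one isBandFamily_strandBand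
      · rw [← h7, h]; exact simpleBraid_deltaPerm hn1
    · rw [List.isChain_map]
      refine List.IsChain.imp_of_mem_imp (fun A B hA hB h => ?_) h2
      obtain ⟨ha, -, ea⟩ := (h1 A hA).1.isNC_and_eq hn1
      obtain ⟨hb, -, eb⟩ := (h1 B hB).1.isNC_and_eq hn1
      rw [← ea, ← eb] at h
      exact (leftWeighted_simpleBraid hn1 ha hb).mp h
    · have e1 : streamHom n (delta n) = (strandInterval n).perm (strandInterval n).top := by
        rw [← simpleBraid_deltaPerm hn1, streamHom_simpleBraid isNC_deltaPerm]
        rfl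
      have e2 : As.map (streamHom n) = As.map ((strandInterval n).perm ∘ toPerm n) := by
        refine List.map_congr_left fun A hA => ?_
        obtain ⟨ha, -, ea⟩ := (h1 A hA).1.isNC_and_eq hn1
        conv_lhs => rw [← ea]
        exact streamHom_simpleBraid ha
      rw [map_mul, map_zpow, map_list_prod, List.map_map, e1, e2]
  obtain ⟨h1, h2, h3, h4⟩ := key hA
  obtain ⟨h5, h6, h7, h8⟩ := key hB
  obtain ⟨h9, h10⟩ := GarsideInterval.canonical_unique (E := strandInterval n)
    (deltaPerm_ne_one hn) h2 h3 h6 h7 (h4.symm.trans h8)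
  exact ⟨h9, by rw [← h1, h10, h5]⟩

/-- Removing the leading factor shifts all positions by one, which `u + 1` absorbs. -/
theorem inverseFactors_cons (u : ℤ) (A : BraidGroup n) (As : List (BraidGroup n)) :
    inverseFactors u (A :: As) =
      inverseFactors (u + 1) As ++ [(tau n ^ (-(u + 1))) (rightComplement A)] := by
  rw [inverseFactors, List.mapIdx_cons, List.reverse_cons, inverseFactors]
  congr 3
  funext i B
  congr 3
  push_cast
  ring

theorem inverseFactors_prod (u : ℤ) (As : List (BraidGroup n)) :
    delta n ^ (-(u + (As.length : ℤ))) * (inverseFactors u As).prod =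
      (delta n ^ u * As.prod)⁻¹ := by
  induction As generalizing u with
  | nil => simp [inverseFactors]
  | cons A As ih =>
    have h := ih (u + 1)
    rw [inverseFactors_cons, List.prod_append, List.prod_singleton, ← mul_assoc, List.length_cons,
      List.prod_cons, tau_zpow_apply, rightComplement]
    have e : (-(u + ((As.length + 1 : ℕ) : ℤ))) = -(u + 1 + (As.length : ℤ)) := by
      push_cast; ring
    rw [e, h, zpow_add_one]
    group

theorem mem_inverseFactors {u : ℤ} {As : List (BraidGroup n)} {B : BraidGroup n}
    (hB : B ∈ inverseFactors u As) :
    ∃ A ∈ As, ∃ m : ℤ, B = (tau n ^ m) (rightComplement A) := by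
  induction As generalizing u with
  | nil => simp [inverseFactors] at hB
  | cons A As ih =>
    rw [inverseFactors_cons, List.mem_append, List.mem_singleton] at hB
    rcases hB with hB | rfl
    · obtain ⟨A', h1, h2⟩ := ih hB
      exact ⟨A', by simp [h1], h2⟩
    · exact ⟨A, by simp, _, rfl⟩

theorem inverseFactors_isChain (hn : 1 ≤ n) (u : ℤ) (As : List (BraidGroup n))
    (hAs : ∀ A ∈ As, IsCanonicalFactor A) (hc : As.IsChain LeftWeighted) :
    (inverseFactors u As).IsChain LeftWeighted := by
  induction As generalizing u with
  | nil => simp [inverseFactors]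
  | cons A As ih =>
    rw [inverseFactors_cons]
    refine List.IsChain.append (ih (u + 1) (fun B hB => hAs B (by simp [hB])) hc.of_cons)
      (List.isChain_singleton _) ?_
    cases As with
    | nil => simp [inverseFactors]
    | cons B As =>
      have hA := hAs A (by simp)
      have hB := hAs B (by simp)
      have h1 := (List.isChain_cons_cons.mp hc).1
      -- The new last pair comes from the old first pair `A`, `B` by part (I), followed by a common
      -- power of `tau`; the `tau` in part (I) accounts for the difference of the two exponents.
      rw [leftWeighted_iff_rightComplement hn hA hB,
        ← leftWeighted_tau_zpow hn (-(u + 1 + 1)) (hB.rightComplement hn)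
          (by simpa using (hA.rightComplement hn).tau_zpow hn 1),
        ← MulAut.mul_apply, ← zpow_add_one] at h1
      rw [show -(u + 1 + 1) + 1 = -(u + 1) by ring] at h1
      intro x hx y hy
      rw [inverseFactors_cons] at hx
      simp only [List.getLast?_append, List.getLast?_singleton, List.head?_cons, Option.some_or,
        Option.mem_def, Option.some.injEq] at hx hy
      rw [← hx, ← hy]
      exact h1

theorem IsLeftCanonicalForm.inv (hn : 1 ≤ n) {W : BraidGroup n} {u : ℤ} {As : List (BraidGroup n)}
    (h : IsLeftCanonicalForm W u As) :
    IsLeftCanonicalForm W⁻¹ (-(u + (As.length : ℤ))) (inverseFactors u As) := by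
  obtain ⟨rfl, h1, h2⟩ := h
  refine ⟨(inverseFactors_prod u As).symm, ?_,
    inverseFactors_isChain hn u As (fun A hA => (h1 A hA).1) h2⟩
  intro B hB
  obtain ⟨A, hA, m, rfl⟩ := mem_inverseFactors hB
  obtain ⟨h3, h4, h5⟩ := h1 A hA
  -- The complement exchanges the two excluded factors `e` and `δ`, and `tau` fixes both.
  refine ⟨(h3.rightComplement hn).tau_zpow hn m, fun h => h5 ?_, fun h => h4 ?_⟩
  · rw [EmbeddingLike.map_eq_one_iff, rightComplement, inv_mul_eq_one] at h
    exact h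
  · have h6 : (tau n ^ m) (delta n) = delta n := by
      rw [tau_zpow_apply]; group
    rw [← h6] at h
    have h7 := (tau n ^ m).injective h
    rwa [rightComplement, mul_eq_right, inv_eq_one] at h7

end CanonicalForm

end BandBraid

theorem mainTheorem11 (n : ℕ) (hn : 2 ≤ n) :
    (∀ A B : BandBraid.BraidGroup n,
      BandBraid.IsCanonicalFactor A → BandBraid.IsCanonicalFactor B →
        (BandBraid.LeftWeighted A B ↔
          BandBraid.LeftWeighted (BandBraid.rightComplement B)
            (BandBraid.tau n (BandBraid.rightComplement A)))) ∧
    (∀ (W : BandBraid.BraidGroup n) (u : ℤ) (As : List (BandBraid.BraidGroup n)),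
      BandBraid.IsLeftCanonicalForm W u As →
        ∀ (v : ℤ) (Bs : List (BandBraid.BraidGroup n)),
          BandBraid.IsLeftCanonicalForm W⁻¹ v Bs ↔
            v = -(u + (As.length : ℤ)) ∧ Bs = BandBraid.inverseFactors u As) := by
  have hn1 : 1 ≤ n := by omega
  refine ⟨fun A B hA hB => BandBraid.leftWeighted_iff_rightComplement hn1 hA hB, ?_⟩
  intro W u As h v Bs
  constructor
  · intro h'
    exact h'.unique hn (h.inv hn1)
  · rintro ⟨rfl, rfl⟩
    exact h.inv hn1
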